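/- Let $(\varepsilon_n)_{n\in\mathbb Z}$ be i.i.d. random elements, let $G$ be a real-valued measurable function, and let $X_n=G(\dots,\varepsilon_{n-1},\varepsilon_n)$, $n\in\mathbb Z$. Assume that $X_n\in\mathcal L^2$ and $\mathbf E X_n=0$. Write $\|\xi\|=(\mathbf E|\xi|^2)^{1/2}$, let $\mathcal F_k=\sigma(\varepsilon_j: j\le k)$, $\mathcal P_k\xi=\mathbf E(\xi\mid\mathcal F_k)-\mathbf E(\xi\mid\mathcal F_{k-1})$, $r(k)=\mathbf E(X_0X_k)$, and let $$f(\theta)=\frac1{2\pi}\sum_{k\in\mathbb Z}r(k)e^{ik\theta},\qquad \theta\in\mathbb R,$$ be the spectral density. For $n\ge1$ put $m=m_n=\lfloor (n-1)/2\rfloor$, $\theta_j=2\pi j/n$, and $$Z_j=\frac{\sum_{k=1}^n X_k\cos(k\theta_j)}{\sqrt{\pi n f(\theta_j)}},\qquad Z_{j+m}=\frac{\sum_{k=1}^n X_k\sin(k\theta_j)}{\sqrt{\pi n f(\theta_j)}},\qquad j=1,\dots,m,$$ which are the real and imaginary parts of $S_n(\theta_j)/\sqrt{\pi n f(\theta_j)}$,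 where $S_n(\theta)=\sum_{k=1}^nX_ke^{ik\theta}$. For $J=\{j_1<\dots<j_p\}\subset\{1,\dots,2m\}$ write $Z_J=(Z_{j_1},\dots,Z_{j_p})'$. Let $\Xi_{m,p}$ be the collection of all $J\subset\{1,\dots,2m\}$ with exactly $p$ elements, $\Omega_p=\{c\in\mathbb R^p:|c|=1\}$ the Euclidean unit sphere, and $\Phi$ the standard normal distribution function. **Theorem 2.1.** Assume that $$\sum_{k=0}^\infty\|\mathcal P_0X_k\|<\infty\qquad\text{and}\qquad \min_{\theta\in\mathbb R}f(\theta)>0 .$$ (The first condition implies $\sum_{k\in\mathbb Z}|r(k)|<\infty$, so that $f$ is well defined and continuous.) Then for any fixed $p\in\mathbb N$, $$\sup_{J\in\Xi_{m,p}}\ \sup_{c\in\Omega_p}\ \sup_{x\in\mathbb R}\bigl|\mathbf P(Z_J'c\le x)-\Phi(x)\bigr|\longrightarrow 0\qquad\text{as } n\to\infty .$$ -/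

import Mathlib

open MeasureTheory ProbabilityTheory Filter Topology
open scoped ENNReal

noncomputable section

namespace SpectralCLT

variable {Ω E : Type*} [MeasurableSpace Ω] [MeasurableSpace E]

/-- The causal process `X_n = G(…, ε_{n-1}, ε_n)`. The infinite past is presented to `G` as the
sequence `k ↦ ε_{n-k}`, `k = 0, 1, 2, …`. -/
def causalProcess (G : (ℕ → E) → ℝ) (ε : ℤ → Ω → E) (n : ℤ) (ω : Ω) : ℝ :=
  G (fun k : ℕ => ε (n - (k : ℤ)) ω)

/-- The σ-algebra `ℱ_k` generated by the innovations `ε_j`, `j ≤ k`. -/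
def pastSigma (ε : ℤ → Ω → E) (k : ℤ) : MeasurableSpace Ω :=
  ⨆ j : Set.Iic k, MeasurableSpace.comap (ε j) inferInstance

/-- The projection `𝒫_k ξ = E(ξ | ℱ_k) - E(ξ | ℱ_{k-1})`. -/
def proj (P : Measure Ω) (ε : ℤ → Ω → E) (k : ℤ) (ξ : Ω → ℝ) : Ω → ℝ :=
  P[ξ | pastSigma ε k] - P[ξ | pastSigma ε (k - 1)]

/-- The covariance function `r(k) = E(X_0 X_k)` (of a centred stationary process). -/
def autocov (P : Measure Ω) (X : ℤ → Ω → ℝ) (k : ℤ) : ℝ :=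
  ∫ ω, X 0 ω * X k ω ∂P

/-- The spectral density `f(θ) = (2π)⁻¹ ∑_{k ∈ ℤ} r(k) e^{ikθ}`. For a stationary process `r` is
even and the sum is real, so that taking the real part only changes the type. -/
def spectralDensity (P : Measure Ω) (X : ℤ → Ω → ℝ) (θ : ℝ) : ℝ :=
  (1 / (2 * Real.pi)) *
    (∑' k : ℤ, (autocov P X k : ℂ) * Complex.exp (Complex.I * (k : ℂ) * (θ : ℂ))).re

/-- The Fourier frequency `θ_j = 2πj/n`. -/
def fourierFreq (n j : ℕ) : ℝ := 2 * Real.pi * (j : ℝ) / (n : ℝ)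

/-- `m_n = ⌊(n-1)/2⌋`, for `n ≥ 1`. -/
def halfCount (n : ℕ) : ℕ := (n - 1) / 2

/-- The normalized Fourier coefficients `Z_j` (cosine, `1 ≤ j ≤ m_n`) and `Z_{j+m_n}`
(sine, `1 ≤ j ≤ m_n`), that is, the real and imaginary parts of
`S_n(θ_j) / √(π n f(θ_j))` where `S_n(θ) = ∑_{k=1}^n X_k e^{ikθ}`. -/
def normFourier (P : Measure Ω) (X : ℤ → Ω → ℝ) (n j : ℕ) (ω : Ω) : ℝ :=
  if j ≤ halfCount n then
    (∑ k ∈ Finset.Icc 1 n, X (k : ℤ) ω * Real.cos ((k : ℝ) * fourierFreq n j)) /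
      Real.sqrt (Real.pi * (n : ℝ) * spectralDensity P X (fourierFreq n j))
  else
    (∑ k ∈ Finset.Icc 1 n, X (k : ℤ) ω * Real.sin ((k : ℝ) * fourierFreq n (j - halfCount n))) /
      Real.sqrt (Real.pi * (n : ℝ) * spectralDensity P X (fourierFreq n (j - halfCount n)))

/-- `Ξ_{m,p}`: the sets `J ⊆ {1, …, 2m}` with exactly `p` elements. -/
def IndexSet (m p : ℕ) : Type :=
  {J : Finset ℕ // J ⊆ Finset.Icc 1 (2 * m) ∧ J.card = p}

/-- The vector `Z_J = (Z_{j_1}, …, Z_{j_p})` for `J = {j_1 < ⋯ < j_p}`. -/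
def normFourierVec (P : Measure Ω) (X : ℤ → Ω → ℝ) (n : ℕ) {p : ℕ}
    (J : IndexSet (halfCount n) p) (ω : Ω) : EuclideanSpace ℝ (Fin p) :=
  WithLp.toLp 2 (fun l => normFourier P X n (J.1.orderEmbOfFin J.2.2 l) ω)

end SpectralCLT

end

/-! Each `Z_J'c` is a weighted sum `∑ a_k X_k` with `|a_k| ≤ C/√n`, where `C` depends only on `p`
and `min f`. If the uniform statement failed, there would be `n_i → ∞` and choices of `J`, `c`, `x`
along which the error stays above some `δ`. So it suffices to prove a central limit theorem for such
arrays of weights, with variance tending to 1, along arbitrary sequences of arguments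
(`tendsto_fourier_cdf`).

Variance: expanding the square gives a double sum of `r(l - k)` against products of cosines, a sine
being a cosine with phase `-π/2`. Up to a boundary error that is `o(n)` because `∑ |r| < ∞`, the sum
over `k` at fixed lag `h = l - k` runs over a full period. Discrete orthogonality then leaves `π n
f(θ_j)` on the diagonal and 0 off it (`abs_variance_sub_one_le`).

Normality: decompose `X_k` into projections `𝒫_{k-i} X_k`. At a fixed lag `i` these are orthogonal
in `k`, so the lag contributes at most `‖𝒫_0 X_i‖ (∑ a_k²)^{1/2}`, and Hannan's condition makes the
lags `i ≥ m` negligible uniformly in the weights. In the remaining `m` lags `X_k` is replaced by a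
bounded function of finitely many innovations. Deleting `L` out of every `N` times then leaves
independent blocks of size `O(1/√n)` (`exists_block_approx`). A third-order expansion of
characteristic functions gives the Gaussian limit (`tendsto_charFun_weighted_sum`).

Uniformity in `x`: weak convergence is convergence in the Lévy–Prokhorov metric, and the normal
distribution function is Lipschitz, so distribution functions converge even at moving arguments
(`tendsto_cdf_sub_of_tendsto_charFun`). -/

open scoped RealInnerProductSpace

namespace SpectralCLT

/-! ### Increasing projections in Hilbert space: orthogonal increments and lag-by-lag bounds. -/

section Projections

variable {H : Type*} [NormedAddCommGroup H] [InnerProductSpace ℝ H]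

/-- An increasing family of orthogonal projections indexed by `ℤ`. -/
structure IsIncreasingProj (E : ℤ → H →ₗ[ℝ] H) : Prop where
  comp_left : ∀ j k x, j ≤ k → E k (E j x) = E j x
  comp_right : ∀ j k x, j ≤ k → E j (E k x) = E j x
  symm : ∀ k x y, ⟪E k x, y⟫ = ⟪x, E k y⟫

/-- The increment `E k - E (k - 1)` of a family of projections. -/
def increment (E : ℤ → H →ₗ[ℝ] H) (k : ℤ) (x : H) : H := E k x - E (k - 1) x

variable {E : ℤ → H →ₗ[ℝ] H}

theorem IsIncreasingProj.norm_le (hE : IsIncreasingProj E) (k : ℤ) (x : H) : ‖E k x‖ ≤ ‖x‖ := by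
  have h : ‖E k x‖ * ‖E k x‖ ≤ ‖x‖ * ‖E k x‖ := by
    rw [← real_inner_self_eq_norm_mul_norm, hE.symm, hE.comp_left k k x le_rfl]
    exact real_inner_le_norm _ _
  rcases (norm_nonneg (E k x)).eq_or_lt with h0 | h0
  · rw [← h0]; exact norm_nonneg _
  · exact le_of_mul_le_mul_right h h0

theorem IsIncreasingProj.apply_increment_of_le (hE : IsIncreasingProj E) {j k : ℤ} (h : j ≤ k)
    (x : H) : E k (increment E j x) = increment E j x := by
  simp only [increment, map_sub]
  rw [hE.comp_left _ _ _ h, hE.comp_left _ _ _ (by lia)]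

theorem IsIncreasingProj.apply_increment_of_lt (hE : IsIncreasingProj E) {j k : ℤ} (h : k < j)
    (x : H) : E k (increment E j x) = 0 := by
  simp only [increment, map_sub]
  rw [hE.comp_right _ _ _ h.le, hE.comp_right _ _ _ (by lia), sub_self]

theorem IsIncreasingProj.increment_symm (hE : IsIncreasingProj E) (k : ℤ) (x y : H) :
    ⟪increment E k x, y⟫ = ⟪x, increment E k y⟫ := by
  simp only [increment, inner_sub_left, inner_sub_right, hE.symm]

theorem IsIncreasingProj.increment_increment_self (hE : IsIncreasingProj E) (k : ℤ) (x : H) :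
    increment E k (increment E k x) = increment E k x := by
  rw [increment, hE.apply_increment_of_le le_rfl, hE.apply_increment_of_lt (by lia), sub_zero]

theorem IsIncreasingProj.increment_increment_of_ne (hE : IsIncreasingProj E) {j k : ℤ}
    (h : j ≠ k) (x : H) : increment E j (increment E k x) = 0 := by
  rw [increment]
  rcases lt_or_gt_of_ne h with h | h
  · rw [hE.apply_increment_of_lt h, hE.apply_increment_of_lt (by lia), sub_zero]
  · rw [hE.apply_increment_of_le h.le, hE.apply_increment_of_le (by lia), sub_self]

theorem IsIncreasingProj.inner_increment (hE : IsIncreasingProj E) (k : ℤ) (x y : H) :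
    ⟪increment E k x, y⟫ = ⟪increment E k x, increment E k y⟫ := by
  rw [← hE.increment_symm, hE.increment_increment_self]

theorem IsIncreasingProj.inner_increment_of_ne (hE : IsIncreasingProj E) {j k : ℤ} (h : j ≠ k)
    (x y : H) : ⟪increment E j x, increment E k y⟫ = 0 := by
  rw [hE.increment_symm, hE.increment_increment_of_ne h, inner_zero_right]

theorem IsIncreasingProj.norm_increment_le (hE : IsIncreasingProj E) (k : ℤ) (x : H) :
    ‖increment E k x‖ ≤ ‖x‖ := by
  have h : ‖increment E k x‖ * ‖increment E k x‖ ≤ ‖increment E k x‖ * ‖x‖ := by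
    rw [← real_inner_self_eq_norm_mul_norm, ← hE.inner_increment]
    exact real_inner_le_norm _ _
  rcases (norm_nonneg (increment E k x)).eq_or_lt with h0 | h0
  · rw [← h0]; exact norm_nonneg _
  · exact le_of_mul_le_mul_left h h0

/-- Pythagoras: with the lag `i` fixed, distinct `k` give increments at distinct times `k - i`,
whatever the vectors `x k` are. -/
theorem IsIncreasingProj.norm_sum_increment_le (hE : IsIncreasingProj E) (s : Finset ℕ)
    (d : ℕ → ℝ) (x : ℕ → H) (i : ℤ) {u : ℝ} (hu : 0 ≤ u)
    (hx : ∀ k ∈ s, ‖increment E ((k : ℤ) - i) (x k)‖ ≤ u) :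
    ‖∑ k ∈ s, d k • increment E ((k : ℤ) - i) (x k)‖ ≤ u * √(∑ k ∈ s, d k ^ 2) := by
  refine abs_le_of_sq_le_sq' ?_ (by positivity) |>.2
  rw [mul_pow, Real.sq_sqrt (by positivity), ← real_inner_self_eq_norm_sq, sum_inner,
    Finset.mul_sum]
  refine Finset.sum_le_sum fun k hk => ?_
  rw [inner_sum, Finset.sum_eq_single k]
  · rw [inner_smul_left, inner_smul_right, real_inner_self_eq_norm_sq]
    have := pow_le_pow_left₀ (norm_nonneg _) (hx k hk) 2
    simp only [conj_trivial]
    nlinarith [mul_le_mul_of_nonneg_left this (sq_nonneg (d k))]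
  · intro _ _ hl
    rw [inner_smul_left, inner_smul_right, hE.inner_increment_of_ne (by lia)]
    simp
  · exact fun h => absurd hk h

theorem sum_increment (E : ℤ → H →ₗ[ℝ] H) (k : ℤ) {a b : ℕ} (hab : a ≤ b) (x : H) :
    ∑ i ∈ Finset.Ico a b, increment E (k - i) x = E (k - a) x - E (k - b) x := by
  induction b, hab using Nat.le_induction with
  | base => simp
  | succ b hab ih =>
    rw [Finset.sum_Ico_succ_top hab, ih, increment]
    push_cast
    rw [show k - (b : ℤ) - 1 = k - (b + 1) by ring]
    abel

/-- The triangle inequality is spent only across lags, while orthogonality is used inside each lag.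
Hence the weights enter through their `ℓ²` norm and the increments through a sum over lags, which is
the form of Hannan's condition. -/
theorem IsIncreasingProj.norm_sum_sub_le (hE : IsIncreasingProj E) (s : Finset ℕ)
    (d : ℕ → ℝ) (x : ℕ → H) {a b : ℕ} (hab : a ≤ b) (u : ℕ → ℝ) (hu : ∀ i, 0 ≤ u i)
    (hx : ∀ i ∈ Finset.Ico a b, ∀ k ∈ s, ‖increment E ((k : ℤ) - i) (x k)‖ ≤ u i) :
    ‖∑ k ∈ s, d k • (E ((k : ℤ) - a) (x k) - E ((k : ℤ) - b) (x k))‖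
      ≤ (∑ i ∈ Finset.Ico a b, u i) * √(∑ k ∈ s, d k ^ 2) := by
  simp_rw [← sum_increment E _ hab, Finset.smul_sum]
  rw [Finset.sum_comm, Finset.sum_mul]
  exact norm_sum_le_of_le _ fun i hi => hE.norm_sum_increment_le s d x i (hu i) (hx i hi)

/-- The covariance bound behind summability of the autocovariances. -/
theorem IsIncreasingProj.abs_inner_sub_le (hE : IsIncreasingProj E) (k : ℤ) (x y : H) (b : ℕ)
    (u v : ℕ → ℝ) (hx : ∀ i : ℕ, ‖increment E (k - i) x‖ ≤ u i)
    (hy : ∀ i : ℕ, ‖increment E (k - i) y‖ ≤ v i) (hxk : E k x = x) :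
    |⟪x, y⟫| ≤ ∑ i ∈ Finset.range b, u i * v i + ‖E (k - b) x‖ * ‖y‖ := by
  have h := sum_increment E k (Nat.zero_le b) x
  have hx' : x = ∑ i ∈ Finset.Ico 0 b, increment E (k - i) x + E (k - b) x := by
    rw [h]; simp [hxk]
  conv_lhs => rw [hx']
  rw [inner_add_left, sum_inner, Nat.Ico_zero_eq_range]
  refine (abs_add_le _ _).trans (add_le_add ((Finset.abs_sum_le_sum_abs _ _).trans
    (Finset.sum_le_sum fun i _ => ?_)) (abs_real_inner_le_norm _ _))
  rw [hE.inner_increment]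
  exact (abs_real_inner_le_norm _ _).trans (mul_le_mul (hx i) (hy i) (norm_nonneg _)
    ((norm_nonneg _).trans (hx i)))

end Projections

/-! ### Conditional expectations given sets of innovations, as projections of `L²`. -/

section CondExp

set_option linter.unusedSectionVars false

variable {Ω E : Type*} {m m₁ m₂ : MeasurableSpace Ω} [mΩ : MeasurableSpace Ω] [mE : MeasurableSpace E]

/-- The σ-algebra generated by the innovations with index in `S`. -/
@[reducible] def sigmaOf (ε : ℤ → Ω → E) (S : Set ℤ) : MeasurableSpace Ω :=
  ⨆ j ∈ S, MeasurableSpace.comap (ε j) mE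

theorem pastSigma_eq_sigmaOf (ε : ℤ → Ω → E) (k : ℤ) :
    pastSigma ε k = sigmaOf ε (Set.Iic k) :=
  iSup_subtype (p := fun j => j ∈ Set.Iic k) (f := fun j => MeasurableSpace.comap (ε j.1) mE)

theorem sigmaOf_le {ε : ℤ → Ω → E} (hε : ∀ i, Measurable (ε i)) (S : Set ℤ) :
    sigmaOf ε S ≤ mΩ :=
  iSup₂_le fun j _ => (hε j).comap_le

theorem sigmaOf_mono (ε : ℤ → Ω → E) {S T : Set ℤ} (h : S ⊆ T) : sigmaOf ε S ≤ sigmaOf ε T :=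
  biSup_mono h

theorem sigmaOf_union (ε : ℤ → Ω → E) (S T : Set ℤ) :
    sigmaOf ε (S ∪ T) = sigmaOf ε S ⊔ sigmaOf ε T :=
  iSup_union

theorem measurable_sigmaOf (ε : ℤ → Ω → E) {S : Set ℤ} {j : ℤ} (hj : j ∈ S) :
    Measurable[sigmaOf ε S] (ε j) :=
  measurable_iff_comap_le.2 (le_iSup₂ (f := fun j _ => MeasurableSpace.comap (ε j) mE) j hj)

variable {P : Measure Ω} [IsProbabilityMeasure P]

theorem indep_sigmaOf {ε : ℤ → Ω → E} (hε : ∀ i, Measurable (ε i)) (hi : iIndepFun ε P)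
    {S T : Set ℤ} (h : Disjoint S T) : Indep (sigmaOf ε S) (sigmaOf ε T) P :=
  indep_iSup_of_disjoint (fun j => (hε j).comap_le) hi h

/-- If `C` is independent of `B ≥ A` and `f` is `B`-measurable, then conditioning on `A ⊔ C` is
the same as conditioning on `A`. -/
theorem condExp_sup_of_indep {A B C : MeasurableSpace Ω} (hAB : A ≤ B) (hB : B ≤ mΩ) (hC : C ≤ mΩ)
    (hind : Indep B C P) {f : Ω → ℝ} (hf : StronglyMeasurable[B] f) (hfi : Integrable f P) :
    P[f | A ⊔ C] =ᵐ[P] P[f | A] := by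
  have hA : A ≤ mΩ := hAB.trans hB
  have hAC : A ⊔ C ≤ mΩ := sup_le hA hC
  have hgen : A ⊔ C = MeasurableSpace.generateFrom
      (Set.image2 (· ∩ ·) {s | MeasurableSet[A] s} {s | MeasurableSet[C] s}) := by
    apply le_antisymm
    · refine sup_le (fun s hs => ?_) (fun s hs => ?_)
      · exact MeasurableSpace.measurableSet_generateFrom
          ⟨s, hs, Set.univ, @MeasurableSet.univ _ C, Set.inter_univ s⟩
      · exact MeasurableSpace.measurableSet_generateFrom
          ⟨Set.univ, @MeasurableSet.univ _ A, s, hs, Set.univ_inter s⟩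
    · refine MeasurableSpace.generateFrom_le ?_
      rintro _ ⟨a, ha, c, hc, rfl⟩
      exact @MeasurableSet.inter _ (A ⊔ C) _ _ ((le_sup_left : A ≤ A ⊔ C) a ha)
        ((le_sup_right : C ≤ A ⊔ C) c hc)
  have hpi : IsPiSystem
      (Set.image2 (· ∩ ·) {s | MeasurableSet[A] s} {s | MeasurableSet[C] s} : Set (Set Ω)) := by
    rintro _ ⟨a, ha, c, hc, rfl⟩ _ ⟨a', ha', c', hc', rfl⟩ _
    exact ⟨a ∩ a', @MeasurableSet.inter _ A _ _ ha ha', c ∩ c', @MeasurableSet.inter _ C _ _ hc hc',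
      by ext; simp only [Set.mem_inter_iff]; tauto⟩
  -- The factorization is applied both to `f` and to `P[f | A]`, so on the generating π-system the
  -- claim reduces to the defining property of `P[f | A]`.
  have hprod : ∀ g : Ω → ℝ, StronglyMeasurable[B] g → Integrable g P → ∀ a c,
      MeasurableSet[A] a → MeasurableSet[C] c →
      ∫ ω in a ∩ c, g ω ∂P = P.real c * ∫ ω in a, g ω ∂P := by
    intro g hg hgi a c ha hc
    have h1 : StronglyMeasurable[B] (a.indicator g) := hg.indicator (hAB a ha)
    have h2 := condExp_indep_eq hB hC h1 hind
    have h3 := setIntegral_condExp hC (hgi.indicator (hA a ha)) hc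
    rw [Set.inter_comm, ← setIntegral_indicator (hA a ha), ← h3,
      setIntegral_congr_ae (g := fun _ => ∫ ω, a.indicator g ω ∂P) (hC c hc)
        (h2.mono fun ω h _ => h), setIntegral_const, integral_indicator (hA a ha), smul_eq_mul]
  refine (ae_eq_condExp_of_forall_setIntegral_eq hAC hfi
    (fun s _ _ => integrable_condExp.integrableOn) (fun s hs _ => ?_)
    ((stronglyMeasurable_condExp.mono le_sup_left).aestronglyMeasurable)).symm
  induction s, hs using MeasurableSpace.induction_on_inter hgen hpi with
  | empty => simp
  | basic t ht =>
    obtain ⟨a, ha, c, hc, rfl⟩ := ht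
    rw [hprod _ (stronglyMeasurable_condExp.mono hAB) integrable_condExp a c ha hc,
      hprod f hf hfi a c ha hc, setIntegral_condExp hA hfi ha]
  | compl t ht ih =>
    have h1 := integral_add_compl (hAC t ht) (integrable_condExp (m := A) (μ := P) (f := f))
    have h2 := integral_add_compl (hAC t ht) hfi
    rw [integral_condExp hA] at h1
    linarith [ih (measure_lt_top _ _)]
  | iUnion t htd ht ih =>
    rw [integral_iUnion (fun i => hAC _ (ht i)) htd integrable_condExp.integrableOn,
      integral_iUnion (fun i => hAC _ (ht i)) htd hfi.integrableOn]
    exact tsum_congr fun i => ih i (measure_lt_top _ _)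

/-- Conditioning a function of the innovations in `S` on the innovations in `T`. -/
theorem condExp_sigmaOf_inter {ε : ℤ → Ω → E} (hε : ∀ i, Measurable (ε i)) (hi : iIndepFun ε P)
    (S T : Set ℤ) {f : Ω → ℝ} (hf : StronglyMeasurable[sigmaOf ε S] f) (hfi : Integrable f P) :
    P[f | sigmaOf ε T] =ᵐ[P] P[f | sigmaOf ε (S ∩ T)] := by
  have hT : sigmaOf ε T = sigmaOf ε (S ∩ T) ⊔ sigmaOf ε (T \ S) := by
    rw [← sigmaOf_union]
    congr 1
    rw [Set.inter_comm, Set.inter_union_sdiff]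
  rw [hT]
  exact condExp_sup_of_indep (sigmaOf_mono ε Set.inter_subset_left) (sigmaOf_le hε S)
    (sigmaOf_le hε _) (indep_sigmaOf hε hi Set.disjoint_sdiff_right) hf hfi

/-- Conditional expectations are transported by a measurable map. -/
theorem condExp_comp_comap {Ω' : Type*} {m : MeasurableSpace Ω'} [mΩ' : MeasurableSpace Ω']
    {W : Ω → Ω'} (hW : Measurable W) (hm : m ≤ mΩ') {f : Ω' → ℝ}
    (hf : Integrable f (P.map W)) :
    P[f ∘ W | m.comap W] =ᵐ[P] (P.map W)[f | m] ∘ W := by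
  have : IsProbabilityMeasure (P.map W) := Measure.isProbabilityMeasure_map hW.aemeasurable
  have hmW : m.comap W ≤ mΩ := (MeasurableSpace.comap_mono hm).trans hW.comap_le
  have hfi : Integrable (f ∘ W) P := hf.comp_measurable hW
  have hci : Integrable ((P.map W)[f | m] ∘ W) P := integrable_condExp.comp_measurable hW
  refine (ae_eq_condExp_of_forall_setIntegral_eq hmW hfi (fun s _ _ => hci.integrableOn)
    (fun s hs _ => ?_) ?_).symm
  · obtain ⟨t, ht, rfl⟩ := hs
    have h1 := setIntegral_map (hm t ht) (integrable_condExp (μ := P.map W) (m := m)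
      (f := f)).aestronglyMeasurable hW.aemeasurable
    have h2 := setIntegral_map (hm t ht) hf.aestronglyMeasurable hW.aemeasurable
    simp only [Function.comp_apply]
    rw [← h1, ← h2, setIntegral_condExp hm hf ht]
  · exact (stronglyMeasurable_condExp.comp_measurable
      (measurable_iff_comap_le.2 le_rfl)).aestronglyMeasurable

variable (P) in
/-- The conditional expectation as a linear map of `L²`. -/
noncomputable def condProj (hm : m ≤ mΩ) : Lp ℝ 2 P →ₗ[ℝ] Lp ℝ 2 P :=
  (lpMeas ℝ ℝ m 2 P).subtype ∘ₗ (condExpL2 ℝ ℝ hm).toLinearMap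

theorem condProj_toLp (hm : m ≤ mΩ) {f : Ω → ℝ} (hf : MemLp f 2 P) :
    condProj P hm (hf.toLp f) =ᵐ[P] P[f | m] :=
  hf.condExpL2_ae_eq_condExp (𝕜 := ℝ) hm

theorem condProj_ae (hm : m ≤ mΩ) (x : Lp ℝ 2 P) :
    condProj P hm x =ᵐ[P] P[x | m] := by
  have h := condProj_toLp hm (Lp.memLp x)
  rwa [Lp.toLp_coeFn] at h

theorem condProj_symm (hm : m ≤ mΩ) (x y : Lp ℝ 2 P) :
    ⟪condProj P hm x, y⟫ = ⟪x, condProj P hm y⟫ :=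
  inner_condExpL2_left_eq_right hm

theorem condProj_comp_of_le (h : m₁ ≤ m₂) (hm : m₂ ≤ mΩ)
    (x : Lp ℝ 2 P) : condProj P (h.trans hm) (condProj P hm x) = condProj P (h.trans hm) x := by
  refine Lp.ext ?_
  filter_upwards [condProj_ae (h.trans hm) (condProj P hm x), condProj_ae (h.trans hm) x,
    condExp_congr_ae (m := m₁) (condProj_ae hm x),
    condExp_condExp_of_le (f := x) (μ := P) h hm] with ω h1 h2 h3 h4
  rw [h1, h2, h3, h4]

theorem condProj_comp_of_ge (h : m₁ ≤ m₂) (hm : m₂ ≤ mΩ)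
    (x : Lp ℝ 2 P) : condProj P hm (condProj P (h.trans hm) x) = condProj P (h.trans hm) x := by
  refine Lp.ext ?_
  have h5 := condExp_of_stronglyMeasurable (μ := P) hm
    ((stronglyMeasurable_condExp (m := m₁) (μ := P) (f := x)).mono h) integrable_condExp
  filter_upwards [condProj_ae hm (condProj P (h.trans hm) x), condProj_ae (h.trans hm) x,
    condExp_congr_ae (m := m₂) (condProj_ae (h.trans hm) x)] with ω h1 h2 h3
  rw [h1, h2, h3, h5]

variable (P) in
/-- The projections on the past, as a family of linear maps of `L²`. -/
noncomputable def pastProj {ε : ℤ → Ω → E} (hε : ∀ i, Measurable (ε i)) (k : ℤ) : Lp ℝ 2 P →ₗ[ℝ] Lp ℝ 2 P :=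
  condProj P (sigmaOf_le hε (Set.Iic k))

theorem isIncreasingProj_pastProj {ε : ℤ → Ω → E} (hε : ∀ i, Measurable (ε i)) :
    IsIncreasingProj (pastProj P hε) where
  comp_left _ _ x h :=
    condProj_comp_of_ge (sigmaOf_mono ε (Set.Iic_subset_Iic.2 h)) (sigmaOf_le hε _) x
  comp_right _ _ x h :=
    condProj_comp_of_le (sigmaOf_mono ε (Set.Iic_subset_Iic.2 h)) (sigmaOf_le hε _) x
  symm _ x y := condProj_symm _ x y

theorem pastProj_toLp {ε : ℤ → Ω → E} (hε : ∀ i, Measurable (ε i)) (k : ℤ) {f : Ω → ℝ}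
    (hf : MemLp f 2 P) :
    pastProj P hε k (hf.toLp f) =ᵐ[P] P[f | sigmaOf ε (Set.Iic k)] :=
  condProj_toLp _ hf

theorem pastProj_toLp_eq_self {ε : ℤ → Ω → E} (hε : ∀ i, Measurable (ε i)) (k : ℤ) {f : Ω → ℝ}
    (hf : MemLp f 2 P) (hm : StronglyMeasurable[sigmaOf ε (Set.Iic k)] f) :
    pastProj P hε k (hf.toLp f) = hf.toLp f := by
  refine Lp.ext ?_
  have h := condExp_of_stronglyMeasurable (μ := P) (sigmaOf_le hε _) hm
    (hf.integrable one_le_two)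
  filter_upwards [pastProj_toLp hε k hf, hf.coeFn_toLp] with ω h1 h2
  rw [h1, h2, h]

theorem memLp_proj {ε : ℤ → Ω → E} (k : ℤ) {f : Ω → ℝ}
    (hf : MemLp f 2 P) : MemLp (proj P ε k f) 2 P :=
  (hf.condExp one_le_two).sub (hf.condExp one_le_two)

theorem norm_increment_toLp {ε : ℤ → Ω → E} (hε : ∀ i, Measurable (ε i)) (k : ℤ) {f : Ω → ℝ}
    (hf : MemLp f 2 P) :
    ‖increment (pastProj P hε) k (hf.toLp f)‖ = (eLpNorm (proj P ε k f) 2 P).toReal := by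
  rw [← Lp.norm_toLp _ (memLp_proj k hf)]
  congr 1
  refine Lp.ext ?_
  rw [increment]
  filter_upwards [(memLp_proj (P := P) (ε := ε) k hf).coeFn_toLp, pastProj_toLp hε k hf,
    pastProj_toLp hε (k - 1) hf,
    Lp.coeFn_sub (pastProj P hε k (hf.toLp f)) (pastProj P hε (k - 1) (hf.toLp f))]
    with ω h1 h2 h3 h4
  rw [h1, h4, proj, pastSigma_eq_sigmaOf, pastSigma_eq_sigmaOf, Pi.sub_apply, Pi.sub_apply, h2, h3]

end CondExp

/-! ### Shift invariance of the process, and approximation by bounded finite-range functionals. -/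

section Stationarity

set_option linter.unusedSectionVars false

variable {Ω E : Type*} [mΩ : MeasurableSpace Ω] [mE : MeasurableSpace E]

theorem norm_toLp_sq {P : Measure Ω} {f : Ω → ℝ} (hf : MemLp f 2 P) :
    ‖hf.toLp f‖ ^ 2 = ∫ ω, f ω ^ 2 ∂P := by
  rw [← real_inner_self_eq_norm_sq, L2.inner_def]
  refine integral_congr_ae ?_
  filter_upwards [hf.coeFn_toLp] with ω h
  rw [h, real_inner_self_eq_norm_sq, Real.norm_eq_abs, sq_abs]

theorem inner_toLp {P : Measure Ω} {f g : Ω → ℝ} (hf : MemLp f 2 P) (hg : MemLp g 2 P) :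
    ⟪hf.toLp f, hg.toLp g⟫ = ∫ ω, f ω * g ω ∂P := by
  rw [L2.inner_def]
  refine integral_congr_ae ?_
  filter_upwards [hf.coeFn_toLp, hg.coeFn_toLp] with ω h1 h2
  rw [h1, h2, real_inner_eq_re_inner, RCLike.inner_apply]
  simp [mul_comm]

theorem abs_integral_le_norm_toLp {P : Measure Ω} [IsProbabilityMeasure P] {f : Ω → ℝ}
    (hf : MemLp f 2 P) : |∫ ω, f ω ∂P| ≤ ‖hf.toLp f‖ := by
  have h1 : MemLp (fun _ : Ω => (1 : ℝ)) 2 P := memLp_const 1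
  have h2 : ‖h1.toLp _‖ ^ 2 = 1 := by rw [norm_toLp_sq]; simp
  have h3 : ‖h1.toLp _‖ = 1 := (pow_eq_one_iff_of_nonneg (norm_nonneg _) two_ne_zero).1 h2
  have h4 := abs_real_inner_le_norm (hf.toLp f) (h1.toLp _)
  rw [inner_toLp, h3] at h4
  simpa using h4

/-- The innovations seen from time `k`. -/
def shiftedPath (ε : ℤ → Ω → E) (k : ℤ) (ω : Ω) : ℤ → E := fun j => ε (k + j) ω

variable {P : Measure Ω} [IsProbabilityMeasure P] {ε : ℤ → Ω → E}

theorem measurable_shiftedPath (hε : ∀ i, Measurable (ε i)) (k : ℤ) :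
    Measurable (shiftedPath ε k) :=
  measurable_pi_lambda _ fun j => hε (k + j)

theorem identDistrib_shiftedPath (hi : iIndepFun ε P)
    (hid : ∀ i j, IdentDistrib (ε i) (ε j) P P) (k l : ℤ) :
    IdentDistrib (shiftedPath ε k) (shiftedPath ε l) P P :=
  IdentDistrib.pi (fun j => hid (k + j) (l + j)) (hi.precomp (add_right_injective k))
    (hi.precomp (add_right_injective l))

theorem sigmaOf_eq_comap_shiftedPath (ε : ℤ → Ω → E) (k l : ℤ) :
    sigmaOf ε (Set.Iic (k + l)) =
      (sigmaOf (fun j (w : ℤ → E) => w j) (Set.Iic l)).comap (shiftedPath ε k) := by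
  simp only [sigmaOf, MeasurableSpace.comap_iSup, MeasurableSpace.comap_comp]
  apply le_antisymm
  · refine iSup₂_le fun j hj => ?_
    have : ε j = (fun w : ℤ → E => w (j - k)) ∘ shiftedPath ε k := by
      funext ω; simp [shiftedPath]
    rw [this]
    exact le_iSup₂ (f := fun j (_ : j ∈ Set.Iic l) =>
      MeasurableSpace.comap ((fun w : ℤ → E => w j) ∘ shiftedPath ε k) mE) (j - k)
      (by simp only [Set.mem_Iic] at hj ⊢; lia)
  · refine iSup₂_le fun j hj => ?_
    exact le_iSup₂ (f := fun j (_ : j ∈ Set.Iic (k + l)) => MeasurableSpace.comap (ε j) mE) (k + j)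
      (by simp only [Set.mem_Iic] at hj ⊢; lia)

theorem causalProcess_eq_comp (G : (ℕ → E) → ℝ) (ε : ℤ → Ω → E) (k l : ℤ) :
    causalProcess G ε (k + l) =
      (fun w : ℤ → E => G fun i : ℕ => w (l - i)) ∘ shiftedPath ε k := by
  funext ω
  simp [causalProcess, shiftedPath, add_sub_assoc]

theorem measurable_pathFunctional {G : (ℕ → E) → ℝ} (hG : Measurable G) (l : ℤ) :
    Measurable fun w : ℤ → E => G fun i : ℕ => w (l - i) :=
  hG.comp (measurable_pi_lambda _ fun _ => measurable_pi_apply _)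

theorem measurable_causalProcess_sigmaOf {G : (ℕ → E) → ℝ} (hG : Measurable G) (ε : ℤ → Ω → E)
    (k : ℤ) : Measurable[sigmaOf ε (Set.Iic k)] (causalProcess G ε k) := by
  have h : Measurable[sigmaOf ε (Set.Iic k)] fun ω (i : ℕ) => ε (k - i) ω :=
    @measurable_pi_lambda _ _ _ (sigmaOf ε (Set.Iic k)) _ _ fun i =>
      measurable_sigmaOf ε (by simp)
  exact hG.comp h

/-- Seen from time `k`, the process and the past are a fixed functional and a fixed σ-algebra on
path space, and the law of the shifted path does not depend on `k`. This turns Hannan's condition,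
stated at time 0, into a bound at all times. -/
theorem eLpNorm_proj_eq {G : (ℕ → E) → ℝ} (hG : Measurable G) (hε : ∀ i, Measurable (ε i))
    (hi : iIndepFun ε P) (hid : ∀ i j, IdentDistrib (ε i) (ε j) P P)
    (hX : ∀ t, MemLp (causalProcess G ε t) 2 P) (k l : ℤ) :
    eLpNorm (proj P ε k (causalProcess G ε (k + l))) 2 P
      = eLpNorm (proj P ε 0 (causalProcess G ε l)) 2 P := by
  set g : (ℤ → E) → ℝ := fun w => G fun i : ℕ => w (l - i) with hg
  have hgm : Measurable g := measurable_pathFunctional hG l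
  have key : ∀ k, eLpNorm (proj P ε k (causalProcess G ε (k + l))) 2 P =
      eLpNorm ((P.map (shiftedPath ε k))[g | sigmaOf (fun j (w : ℤ → E) => w j) (Set.Iic 0)] -
        (P.map (shiftedPath ε k))[g | sigmaOf (fun j (w : ℤ → E) => w j) (Set.Iic (-1))]) 2
        (P.map (shiftedPath ε k)) := by
    intro k
    have hW := measurable_shiftedPath hε k
    have : IsProbabilityMeasure (P.map (shiftedPath ε k)) :=
      Measure.isProbabilityMeasure_map hW.aemeasurable
    have hgi : Integrable g (P.map (shiftedPath ε k)) := by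
      rw [integrable_map_measure hgm.aestronglyMeasurable hW.aemeasurable, hg,
        ← causalProcess_eq_comp]
      exact (hX _).integrable one_le_two
    have hle : ∀ S, sigmaOf (fun j (w : ℤ → E) => w j) S ≤ MeasurableSpace.pi :=
      sigmaOf_le fun j => measurable_pi_apply j
    have h0 := condExp_comp_comap (P := P) hW (hle (Set.Iic 0)) hgi
    have h1 := condExp_comp_comap (P := P) hW (hle (Set.Iic (-1))) hgi
    rw [eLpNorm_map_measure (integrable_condExp.sub integrable_condExp).aestronglyMeasurable
      hW.aemeasurable, proj, pastSigma_eq_sigmaOf, pastSigma_eq_sigmaOf, causalProcess_eq_comp]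
    refine eLpNorm_congr_ae ?_
    rw [← sigmaOf_eq_comap_shiftedPath, add_zero] at h0
    rw [← sigmaOf_eq_comap_shiftedPath, ← sub_eq_add_neg] at h1
    filter_upwards [h0, h1] with ω h0 h1
    simp only [Pi.sub_apply, Function.comp_apply] at h0 h1 ⊢
    rw [← h0, ← h1]
  have h0 := key 0
  rw [zero_add, ← (identDistrib_shiftedPath hi hid k 0).map_eq] at h0
  rw [key k, h0]

theorem integral_mul_eq_autocov {G : (ℕ → E) → ℝ} (hG : Measurable G)
    (hi : iIndepFun ε P) (hid : ∀ i j, IdentDistrib (ε i) (ε j) P P) (k l : ℤ) :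
    ∫ ω, causalProcess G ε k ω * causalProcess G ε l ω ∂P
      = autocov P (causalProcess G ε) (l - k) := by
  have h := ((identDistrib_shiftedPath hi hid k 0).comp ((measurable_pathFunctional hG 0).mul
    (measurable_pathFunctional hG (l - k)))).integral_eq
  have e : ∀ j, causalProcess G ε j =
      (fun w : ℤ → E => G fun i : ℕ => w (j - k - i)) ∘ shiftedPath ε k := fun j => by
    rw [← causalProcess_eq_comp]; congr 1; ring
  have e0 : ∀ j, causalProcess G ε j =
      (fun w : ℤ → E => G fun i : ℕ => w (j - i)) ∘ shiftedPath ε 0 := fun j => by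
    rw [← causalProcess_eq_comp, zero_add]
  rw [autocov, e0 0, e0 (l - k), e k, e l, sub_self]
  exact h

theorem autocov_neg {G : (ℕ → E) → ℝ} (hG : Measurable G)
    (hi : iIndepFun ε P) (hid : ∀ i j, IdentDistrib (ε i) (ε j) P P) (k : ℤ) :
    autocov P (causalProcess G ε) (-k) = autocov P (causalProcess G ε) k := by
  have h := integral_mul_eq_autocov hG hi hid k 0
  rw [zero_sub] at h
  rw [← h, autocov]
  simp_rw [mul_comm]

/-- A square-integrable function of a sequence is approximated by bounded functions of finitely
many coordinates. -/
theorem exists_bounded_cylinder_approx (ν : Measure (ℕ → E)) [IsProbabilityMeasure ν]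
    {G : (ℕ → E) → ℝ} (hG : MemLp G 2 ν) {η : ℝ} (hη : 0 < η) :
    ∃ (L : ℕ) (B : ℝ) (h : (ℕ → E) → ℝ),
      StronglyMeasurable[Filtration.piLE (X := fun _ : ℕ => E) L] h ∧ (∀ s, |h s| ≤ B) ∧
        ∫ s, (G s - h s) ^ 2 ∂ν ≤ η := by
  obtain ⟨g, hg, hgL⟩ := hG.exists_simpleFunc_eLpNorm_sub_lt (by simp)
    (ε := ENNReal.ofReal √(η / 4)) (by simpa using hη)
  obtain ⟨B, hB⟩ := g.exists_forall_norm_le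
  simp only [Real.norm_eq_abs] at hB
  have hB0 : 0 ≤ B := (abs_nonneg _).trans (hB fun _ => (Classical.choice
    (nonempty_of_isProbabilityMeasure ν) : ℕ → E) 0)
  -- A conditional expectation of `g` is bounded by `B` only almost everywhere. Clipping makes the
  -- bound hold everywhere and does not disturb the limit, since `|g| ≤ B`.
  let c : ℕ → (ℕ → E) → ℝ := fun n s =>
    max (-B) (min B ((ν[g | Filtration.piLE (X := fun _ : ℕ => E) n]) s))
  have hcB : ∀ n s, |c n s| ≤ B := fun n s =>
    abs_le.2 ⟨le_max_left _ _, max_le (by linarith) (min_le_left _ _)⟩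
  have hcm : ∀ n, StronglyMeasurable[Filtration.piLE (X := fun _ : ℕ => E) n] (c n) := fun n =>
    (measurable_const.max (measurable_const.min stronglyMeasurable_condExp.measurable)).stronglyMeasurable
  have hcm' : ∀ n, AEStronglyMeasurable (c n) ν := fun n =>
    ((hcm n).mono ((Filtration.piLE (X := fun _ : ℕ => E)).le n)).aestronglyMeasurable
  -- The coordinates generate the product σ-algebra, so Lévy's upward theorem gives convergence back
  -- to `g` itself.
  have hsup : ⨆ n, Filtration.piLE (X := fun _ : ℕ => E) n = MeasurableSpace.pi := by
    apply le_antisymm (iSup_le fun n => (Filtration.piLE (X := fun _ : ℕ => E)).le n)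
    refine iSup_le fun i => ?_
    refine le_trans ?_ (le_iSup _ i)
    have hm : Measurable (fun w : (j : Set.Iic i) → E => w ⟨i, Set.mem_Iic.2 le_rfl⟩) :=
      measurable_pi_apply (⟨i, Set.mem_Iic.2 le_rfl⟩ : Set.Iic i)
    rw [show (fun w : ℕ → E => w i) =
      (fun w : (j : Set.Iic i) → E => w ⟨i, Set.mem_Iic.2 le_rfl⟩) ∘ Preorder.restrictLe i from rfl,
      ← MeasurableSpace.comap_comp]
    exact MeasurableSpace.comap_mono hm.comap_le
  have hlim : Tendsto (fun n => ∫ s, (g s - c n s) ^ 2 ∂ν) atTop (𝓝 (∫ _, (0 : ℝ) ∂ν)) := by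
    refine tendsto_integral_of_dominated_convergence (fun _ => (2 * B) ^ 2)
      (fun n => (g.aestronglyMeasurable.sub (hcm' n)).pow 2) (integrable_const _) (fun n => ?_) ?_
    · refine ae_of_all _ fun s => ?_
      rw [Real.norm_eq_abs, abs_of_nonneg (sq_nonneg _), sq_le_sq, abs_of_nonneg (a := 2 * B)
        (by linarith)]
      exact (abs_sub _ _).trans (by linarith [hB s, hcB n s])
    · have h := Integrable.tendsto_ae_condExp (ℱ := Filtration.piLE (X := fun _ : ℕ => E))
        (μ := ν) (g := g) (g.integrable_of_isFiniteMeasure)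
        (by rw [hsup]; exact g.stronglyMeasurable)
      filter_upwards [h] with s hs
      have h2 : Tendsto (fun n => c n s) atTop (𝓝 (max (-B) (min B (g s)))) :=
        (tendsto_const_nhds.max (tendsto_const_nhds.min hs))
      rw [min_eq_right (abs_le.1 (hB s)).2, max_eq_right (abs_le.1 (hB s)).1] at h2
      have h3 := (tendsto_const_nhds (x := g s)).sub h2
      simpa using h3.pow 2
  rw [integral_zero] at hlim
  obtain ⟨n, hn⟩ := (hlim.eventually (gt_mem_nhds (show 0 < η / 4 by linarith))).exists
  have hcL : MemLp (c n) 2 ν := MemLp.of_bound (hcm' n) B (ae_of_all _ (hcB n))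
  refine ⟨n, B, c n, hcm n, hcB n, ?_⟩
  have h1 : ∫ s, (G s - g s) ^ 2 ∂ν ≤ η / 4 := by
    have hh := hG.sub hgL
    have h2 := norm_toLp_sq hh
    rw [Lp.norm_toLp] at h2
    simp only [Pi.sub_apply] at h2
    rw [← h2, ← Real.sq_sqrt (show 0 ≤ η / 4 by linarith)]
    refine pow_le_pow_left₀ ENNReal.toReal_nonneg ?_ 2
    exact ENNReal.toReal_le_of_le_ofReal (Real.sqrt_nonneg _) hg.le
  have i1 : Integrable (fun s => (G s - g s) ^ 2) ν := (hG.sub hgL).integrable_sq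
  have i2 : Integrable (fun s => (g s - c n s) ^ 2) ν := (hgL.sub hcL).integrable_sq
  calc ∫ s, (G s - c n s) ^ 2 ∂ν
      ≤ ∫ s, (2 * (G s - g s) ^ 2 + 2 * (g s - c n s) ^ 2) ∂ν := by
        refine integral_mono (hG.sub hcL).integrable_sq ((i1.const_mul 2).add (i2.const_mul 2))
          fun s => ?_
        nlinarith [sq_nonneg ((G s - g s) - (g s - c n s))]
    _ ≤ η := by
        rw [integral_add (i1.const_mul 2) (i2.const_mul 2), integral_const_mul,
          integral_const_mul]
        linarith

/-- The causal process is approximated by bounded functions of finitely many innovations,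
uniformly in time. -/
theorem exists_bounded_approx {G : (ℕ → E) → ℝ} (hG : Measurable G) (hε : ∀ i, Measurable (ε i))
    (hi : iIndepFun ε P) (hid : ∀ i j, IdentDistrib (ε i) (ε j) P P)
    (hX : ∀ t, MemLp (causalProcess G ε t) 2 P) {δ : ℝ} (hδ : 0 < δ) :
    ∃ (L : ℕ) (B : ℝ) (Y : ℤ → Ω → ℝ),
      (∀ k, StronglyMeasurable[sigmaOf ε (Set.Icc (k - L) k)] (Y k)) ∧ (∀ k ω, |Y k ω| ≤ B) ∧
        ∀ k, eLpNorm (causalProcess G ε k - Y k) 2 P ≤ ENNReal.ofReal δ := by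
  let S : ℤ → Ω → ℕ → E := fun k ω i => ε (k - i) ω
  have hS : ∀ k, Measurable (S k) := fun k => measurable_pi_lambda _ fun i => hε _
  have hSk : ∀ k, P.map (S k) = P.map (S 0) := fun k =>
    (IdentDistrib.pi (fun i : ℕ => hid (k - i) (0 - i))
      (hi.precomp (g := fun i : ℕ => k - (i : ℤ)) fun a b h => by simpa using h)
      (hi.precomp (g := fun i : ℕ => 0 - (i : ℤ)) fun a b h => by simpa using h)).map_eq
  have : IsProbabilityMeasure (P.map (S 0)) :=
    Measure.isProbabilityMeasure_map (hS 0).aemeasurable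
  have hGL : MemLp G 2 (P.map (S 0)) :=
    (memLp_map_measure_iff hG.aestronglyMeasurable (hS 0).aemeasurable).2 (hX 0)
  obtain ⟨L, B, h, hm, hB, hh⟩ := exists_bounded_cylinder_approx _ hGL (sq_pos_of_pos hδ)
  refine ⟨L, B, fun k => h ∘ S k, fun k => ?_, fun k ω => hB _, fun k => ?_⟩
  · refine hm.comp_measurable ?_
    refine measurable_comap_iff.2 ?_
    refine @measurable_pi_lambda _ _ _ (sigmaOf ε (Set.Icc (k - L) k)) _ _ fun i => ?_
    have := i.2
    exact measurable_sigmaOf ε ⟨by simp only [Set.mem_Iic] at this; lia, by lia⟩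
  · have hhm : AEStronglyMeasurable h (P.map (S 0)) :=
      (hm.mono ((Filtration.piLE (X := fun _ : ℕ => E)).le L)).aestronglyMeasurable
    have hhL : MemLp h 2 (P.map (S 0)) := MemLp.of_bound hhm B (ae_of_all _ hB)
    have e : causalProcess G ε k - h ∘ S k = (G - h) ∘ S k := rfl
    rw [e, ← eLpNorm_map_measure (by rw [hSk]; exact (hGL.sub hhL).aestronglyMeasurable)
      (hS k).aemeasurable, hSk]
    have h2 := norm_toLp_sq (hGL.sub hhL)
    rw [Lp.norm_toLp] at h2
    rw [← ENNReal.ofReal_toReal (hGL.sub hhL).eLpNorm_ne_top]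
    refine ENNReal.ofReal_le_ofReal ?_
    refine abs_le_of_sq_le_sq' ?_ hδ.le |>.2
    rw [h2]
    exact hh

end Stationarity

/-! ### The three-term approximation error, vanishing remote past, and summable autocovariances. -/

section BlockApprox

set_option linter.unusedSectionVars false

/-- The difference splits exactly into three sums: the lags beyond `m` of `x`, the first `m` lags of
`x - y`, and the first `m` lags of `y` at discarded times. Each is bounded by `norm_sum_sub_le`. -/
theorem IsIncreasingProj.norm_sum_sub_kept_le {H : Type*} [NormedAddCommGroup H]
    [InnerProductSpace ℝ H] {E : ℤ → H →ₗ[ℝ] H} (hE : IsIncreasingProj E) (s : Finset ℕ)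
    (q : ℕ → Prop) [DecidablePred q] (a : ℕ → ℝ) (x y : ℕ → H)
    (hx : ∀ k : ℕ, E k (x k) = x k) (hy : ∀ k : ℕ, E k (y k) = y k) (m : ℕ) (u : ℕ → ℝ)
    (hu : ∀ i, 0 ≤ u i) (hxu : ∀ i k : ℕ, ‖increment E ((k : ℤ) - i) (x k)‖ ≤ u i)
    (hlim : ∀ k : ℕ, Tendsto (fun M : ℕ => ‖E ((k : ℤ) - M) (x k)‖) atTop (𝓝 0))
    {δ B η : ℝ} (hδ : 0 ≤ δ) (hB : 0 ≤ B) (hxy : ∀ k, ‖x k - y k‖ ≤ δ) (hyB : ∀ k, ‖y k‖ ≤ B)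
    (htail : ∀ M, ∑ i ∈ Finset.Ico m M, u i ≤ η) :
    ‖∑ k ∈ s, a k • x k - ∑ k ∈ s with q k, a k • (y k - E ((k : ℤ) - m) (y k))‖
      ≤ η * √(∑ k ∈ s, a k ^ 2) + m * δ * √(∑ k ∈ s, a k ^ 2)
        + m * B * √(∑ k ∈ s with ¬ q k, a k ^ 2) := by
  have h1 : ‖∑ k ∈ s, a k • E ((k : ℤ) - m) (x k)‖ ≤ η * √(∑ k ∈ s, a k ^ 2) := by
    -- The lag bound covers only finitely many lags, so the past is cut at `M` and the remainder is
    -- sent to zero as `M → ∞`.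
    have hl : Tendsto (fun M : ℕ => η * √(∑ k ∈ s, a k ^ 2)
        + ∑ k ∈ s, |a k| * ‖E ((k : ℤ) - M) (x k)‖) atTop
        (𝓝 (η * √(∑ k ∈ s, a k ^ 2) + ∑ k ∈ s, |a k| * 0)) :=
      tendsto_const_nhds.add (tendsto_finsetSum _ fun k _ => (hlim k).const_mul _)
    simp only [mul_zero, Finset.sum_const_zero, add_zero] at hl
    refine ge_of_tendsto hl (eventually_atTop.2 ⟨m, fun M hM => ?_⟩)
    have e : ∑ k ∈ s, a k • E ((k : ℤ) - m) (x k) =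
        ∑ k ∈ s, a k • (E ((k : ℤ) - m) (x k) - E ((k : ℤ) - M) (x k))
          + ∑ k ∈ s, a k • E ((k : ℤ) - M) (x k) := by
      rw [← Finset.sum_add_distrib]
      exact Finset.sum_congr rfl fun k _ => by rw [← smul_add, sub_add_cancel]
    rw [e]
    refine (norm_add_le _ _).trans (add_le_add ?_ ?_)
    · exact (hE.norm_sum_sub_le s a x hM u hu fun i _ k _ => hxu i k).trans
        (mul_le_mul_of_nonneg_right (htail M) (Real.sqrt_nonneg _))
    · refine norm_sum_le_of_le _ fun k _ => ?_
      rw [norm_smul, Real.norm_eq_abs]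
  have h2 : ‖∑ k ∈ s, a k • ((x k - y k) - E ((k : ℤ) - m) (x k - y k))‖
      ≤ m * δ * √(∑ k ∈ s, a k ^ 2) := by
    have h := hE.norm_sum_sub_le s a (fun k => x k - y k) (Nat.zero_le m) (fun _ => δ)
      (fun _ => hδ) fun i _ k _ => (hE.norm_increment_le _ _).trans (hxy k)
    simpa [map_sub, hx, hy] using h
  have h3 : ‖∑ k ∈ s with ¬ q k, a k • (y k - E ((k : ℤ) - m) (y k))‖
      ≤ m * B * √(∑ k ∈ s with ¬ q k, a k ^ 2) := by
    have h := hE.norm_sum_sub_le (s.filter fun k => ¬ q k) a y (Nat.zero_le m) (fun _ => B)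
      (fun _ => hB) fun i _ k _ => (hE.norm_increment_le _ _).trans (hyB k)
    simpa [hy] using h
  have e : ∑ k ∈ s, a k • x k - ∑ k ∈ s with q k, a k • (y k - E ((k : ℤ) - m) (y k)) =
      ∑ k ∈ s, a k • E ((k : ℤ) - m) (x k)
        + ∑ k ∈ s, a k • ((x k - y k) - E ((k : ℤ) - m) (x k - y k))
        + ∑ k ∈ s with ¬ q k, a k • (y k - E ((k : ℤ) - m) (y k)) := by
    rw [sub_eq_iff_eq_add, add_assoc, add_comm (Finset.sum (s.filter fun k => ¬ q k) _),
      Finset.sum_filter_add_sum_filter_not, ← Finset.sum_add_distrib, ← Finset.sum_add_distrib]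
    refine Finset.sum_congr rfl fun k _ => ?_
    rw [← smul_add, ← smul_add, map_sub]
    congr 1
    abel
  rw [e]
  exact (norm_add₃_le).trans (add_le_add (add_le_add h1 h2) h3)

theorem card_filter_mod_lt_le (N n L : ℕ) :
    ((Finset.Icc 1 n).filter fun k => ¬ L ≤ k % N).card ≤ L * (n / N + 1) := by
  have h : ((Finset.Icc 1 n).filter fun k => ¬ L ≤ k % N) ⊆
      (Finset.range (n / N + 1) ×ˢ Finset.range L).image fun x => N * x.1 + x.2 := by
    intro k hk
    simp only [Finset.mem_filter, Finset.mem_Icc, not_le] at hk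
    refine Finset.mem_image.2 ⟨(k / N, k % N), ?_, Nat.div_add_mod k N⟩
    simp only [Finset.mem_product, Finset.mem_range]
    exact ⟨Nat.lt_succ_of_le (Nat.div_le_div_right hk.1.2), hk.2⟩
  refine (Finset.card_le_card h).trans (Finset.card_image_le.trans ?_)
  rw [Finset.card_product, Finset.card_range, Finset.card_range, mul_comm]

theorem card_filter_div_eq_le {N : ℕ} (hN : 0 < N) (s : Finset ℕ) (b : ℕ) :
    (s.filter fun k => k / N = b).card ≤ N := by
  have h : (s.filter fun k => k / N = b) ⊆ (Finset.range N).image fun r => N * b + r := by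
    intro k hk
    simp only [Finset.mem_filter] at hk
    refine Finset.mem_image.2 ⟨k % N, Finset.mem_range.2 (Nat.mod_lt _ hN), ?_⟩
    rw [← hk.2, Nat.div_add_mod]
  exact (Finset.card_le_card h).trans (Finset.card_image_le.trans_eq (Finset.card_range N))

variable {Ω E : Type*} [mΩ : MeasurableSpace Ω] [mE : MeasurableSpace E]
  {P : Measure Ω} [IsProbabilityMeasure P] {ε : ℤ → Ω → E} {G : (ℕ → E) → ℝ}

theorem norm_toLp_le_of_eLpNorm_le {f : Ω → ℝ} (hf : MemLp f 2 P) {δ : ℝ} (hδ : 0 ≤ δ)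
    (h : eLpNorm f 2 P ≤ ENNReal.ofReal δ) : ‖hf.toLp f‖ ≤ δ := by
  rw [Lp.norm_toLp]
  exact ENNReal.toReal_le_of_le_ofReal hδ h

theorem norm_toLp_le_of_bound {f : Ω → ℝ} (hf : MemLp f 2 P) {B : ℝ} (hB : 0 ≤ B)
    (h : ∀ ω, |f ω| ≤ B) : ‖hf.toLp f‖ ≤ B := by
  refine abs_le_of_sq_le_sq' ?_ hB |>.2
  rw [norm_toLp_sq]
  calc ∫ ω, f ω ^ 2 ∂P ≤ ∫ _, B ^ 2 ∂P :=
        integral_mono hf.integrable_sq (integrable_const _) fun ω => by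
          rw [← sq_abs]
          exact pow_le_pow_left₀ (abs_nonneg _) (h ω) 2
    _ = B ^ 2 := by simp

/-- A finite-range approximation of `X_k` is independent of the past before its window, so its
projection there is the constant given by its mean. That mean is small because `X_k` is centred. -/
theorem tendsto_norm_pastProj (hG : Measurable G) (hε : ∀ i, Measurable (ε i))
    (hi : iIndepFun ε P) (hid : ∀ i j, IdentDistrib (ε i) (ε j) P P)
    (hX : ∀ t, MemLp (causalProcess G ε t) 2 P) (hmean : ∀ t, ∫ ω, causalProcess G ε t ω ∂P = 0)
    (k : ℤ) :
    Tendsto (fun M : ℕ => ‖pastProj P hε (k - M) ((hX k).toLp _)‖) atTop (𝓝 0) := by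
  rw [Metric.tendsto_atTop]
  intro η hη
  obtain ⟨L, B, Y, hYm, hYB, hXY⟩ :=
    exists_bounded_approx hG hε hi hid hX (show 0 < η / 3 by linarith)
  refine ⟨L + 1, fun M hM => ?_⟩
  have hYL : MemLp (Y k) 2 P :=
    MemLp.of_bound ((hYm k).mono (sigmaOf_le hε _)).aestronglyMeasurable B (ae_of_all _ (hYB k))
  have hd : ‖((hX k).sub hYL).toLp _‖ ≤ η / 3 :=
    norm_toLp_le_of_eLpNorm_le _ (by linarith) (hXY k)
  have h1 : ‖pastProj P hε (k - M) (hYL.toLp _)‖ ≤ η / 3 := by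
    have hdis : Disjoint (Set.Icc (k - L) k) (Set.Iic (k - M)) := by
      rw [Set.disjoint_left]
      intro j hj hj'
      simp only [Set.mem_Icc, Set.mem_Iic] at hj hj'
      lia
    have hc := condExp_indep_eq (sigmaOf_le hε _) (sigmaOf_le hε _) (hYm k)
      (indep_sigmaOf hε hi hdis)
    have hc' : pastProj P hε (k - M) (hYL.toLp _) =ᵐ[P] fun _ => ∫ ω, Y k ω ∂P :=
      (pastProj_toLp hε _ hYL).trans hc
    rw [Lp.norm_def, eLpNorm_congr_ae hc', eLpNorm_const _ (by simp) (IsProbabilityMeasure.ne_zero P)]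
    simp only [measure_univ, ENNReal.one_rpow, mul_one, toReal_enorm, Real.norm_eq_abs]
    refine le_trans ?_ ((abs_integral_le_norm_toLp ((hX k).sub hYL)).trans hd)
    simp only [Pi.sub_apply]
    rw [integral_sub ((hX k).integrable one_le_two) (hYL.integrable one_le_two), hmean, zero_sub,
      abs_neg]
  have h2 : (hX k).toLp _ = ((hX k).sub hYL).toLp _ + hYL.toLp _ := by
    rw [MemLp.toLp_sub (hX k) hYL, sub_add_cancel]
  rw [dist_zero_right, norm_norm, h2, map_add]
  refine (norm_add_le _ _).trans_lt ?_
  have h3 := (isIncreasingProj_pastProj (P := P) hε).norm_le (k - M) (((hX k).sub hYL).toLp _)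
  linarith

/-- The coefficients `‖P_0 X_i‖` of Hannan's condition. -/
noncomputable def hannanCoeff (P : Measure Ω) (G : (ℕ → E) → ℝ) (ε : ℤ → Ω → E) (i : ℕ) : ℝ :=
  (eLpNorm (proj P ε 0 (causalProcess G ε i)) 2 P).toReal

theorem norm_increment_causalProcess (hG : Measurable G) (hε : ∀ i, Measurable (ε i))
    (hi : iIndepFun ε P) (hid : ∀ i j, IdentDistrib (ε i) (ε j) P P)
    (hX : ∀ t, MemLp (causalProcess G ε t) 2 P) (k : ℤ) (i : ℕ) :
    ‖increment (pastProj P hε) (k - i) ((hX k).toLp _)‖ = hannanCoeff P G ε i := by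
  rw [norm_increment_toLp, hannanCoeff, ← eLpNorm_proj_eq hG hε hi hid hX (k - i) i,
    sub_add_cancel]

theorem pastProj_causalProcess (hG : Measurable G) (hε : ∀ i, Measurable (ε i))
    (hX : ∀ t, MemLp (causalProcess G ε t) 2 P) (k : ℤ) :
    pastProj P hε k ((hX k).toLp _) = (hX k).toLp _ :=
  pastProj_toLp_eq_self hε k (hX k)
    (measurable_causalProcess_sigmaOf hG ε k).stronglyMeasurable

/-- The increment at time `-i` is at lag `i` for `X_0` but at lag `i + h` for `X_h`, which explains
the shifted product. -/
theorem abs_autocov_le (hG : Measurable G) (hε : ∀ i, Measurable (ε i))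
    (hi : iIndepFun ε P) (hid : ∀ i j, IdentDistrib (ε i) (ε j) P P)
    (hX : ∀ t, MemLp (causalProcess G ε t) 2 P) (h b : ℕ) :
    |autocov P (causalProcess G ε) h| ≤
      ∑ i ∈ Finset.range b, hannanCoeff P G ε i * hannanCoeff P G ε (i + h)
        + ‖pastProj P hε (0 - b) ((hX 0).toLp _)‖ * ‖(hX h).toLp _‖ := by
  have hE := isIncreasingProj_pastProj (P := P) hε
  rw [autocov, ← inner_toLp (hX 0) (hX h)]
  refine hE.abs_inner_sub_le 0 _ _ b (hannanCoeff P G ε) (fun i => hannanCoeff P G ε (i + h))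
    (fun i => ?_) (fun i => ?_) (pastProj_causalProcess hG hε hX 0)
  · exact (norm_increment_causalProcess hG hε hi hid hX 0 i).le
  · have := norm_increment_causalProcess hG hε hi hid hX h (i + h)
    rw [← this]
    push_cast
    rw [show (h : ℤ) - (i + h) = 0 - i by ring]

theorem hannanCoeff_nonneg (P : Measure Ω) (G : (ℕ → E) → ℝ) (ε : ℤ → Ω → E) (i : ℕ) :
    0 ≤ hannanCoeff P G ε i :=
  ENNReal.toReal_nonneg

/-- The map `(h, i) ↦ (i, i + h)` is injective, so this is a subfamily of the summable family `u i *
u j`. -/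
theorem summable_mul_shift {u : ℕ → ℝ} (hu0 : ∀ i, 0 ≤ u i) (hu : Summable u) :
    Summable fun x : ℕ × ℕ => u x.2 * u (x.2 + x.1) := by
  have h2 : Summable fun x : ℕ × ℕ => u x.1 * u x.2 := hu.mul_of_nonneg hu hu0 hu0
  have hinj : Function.Injective fun x : ℕ × ℕ => (x.2, x.2 + x.1) := by
    rintro ⟨a, b⟩ ⟨c, d⟩ h
    simp only [Prod.mk.injEq] at h ⊢
    lia
  exact h2.comp_injective hinj

/-- Hannan's condition implies that the autocovariances are summable. -/
theorem summable_autocov (hG : Measurable G) (hε : ∀ i, Measurable (ε i))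
    (hi : iIndepFun ε P) (hid : ∀ i j, IdentDistrib (ε i) (ε j) P P)
    (hX : ∀ t, MemLp (causalProcess G ε t) 2 P) (hmean : ∀ t, ∫ ω, causalProcess G ε t ω ∂P = 0)
    (hu : Summable (hannanCoeff P G ε)) :
    Summable (autocov P (causalProcess G ε)) := by
  have hu0 := hannanCoeff_nonneg P G ε
  have h3 := summable_mul_shift hu0 hu
  have hbound : ∀ h : ℕ, ‖autocov P (causalProcess G ε) h‖ ≤
      ∑' i, hannanCoeff P G ε i * hannanCoeff P G ε (i + h) := by
    intro h
    have hs : Summable fun i => hannanCoeff P G ε i * hannanCoeff P G ε (i + h) :=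
      h3.prod_factor h
    have hl := (tendsto_norm_pastProj hG hε hi hid hX hmean 0).mul_const ‖(hX h).toLp _‖
    rw [zero_mul] at hl
    have hl' := (tendsto_const_nhds
      (x := ∑' i, hannanCoeff P G ε i * hannanCoeff P G ε (i + h))).add hl
    rw [add_zero] at hl'
    refine ge_of_tendsto hl' (Eventually.of_forall fun b => ?_)
    refine (abs_autocov_le hG hε hi hid hX h b).trans (add_le_add ?_ le_rfl)
    exact hs.sum_le_tsum _ fun i _ => mul_nonneg (hu0 _) (hu0 _)
  have hn : Summable fun h : ℕ => autocov P (causalProcess G ε) h :=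
    Summable.of_norm_bounded h3.prod hbound
  refine Summable.of_nat_of_neg hn ?_
  simpa only [autocov_neg hG hi hid] using hn

end BlockApprox

/-! ### Independent blocks approximating a weighted sum. -/

section Blocks

set_option linter.unusedSectionVars false

variable {Ω E : Type*} [mΩ : MeasurableSpace Ω] [mE : MeasurableSpace E]
  {P : Measure Ω} [IsProbabilityMeasure P] {ε : ℤ → Ω → E} {G : (ℕ → E) → ℝ}

theorem memLp_sum_mul {ι : Type*} (s : Finset ι) (a : ι → ℝ) {X : ι → Ω → ℝ}
    (hX : ∀ k, MemLp (X k) 2 P) : MemLp (fun ω => ∑ k ∈ s, a k * X k ω) 2 P :=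
  memLp_finsetSum s fun k _ => (hX k).const_mul (a k)

theorem toLp_sum_mul {ι : Type*} (s : Finset ι) (a : ι → ℝ) {X : ι → Ω → ℝ}
    (hX : ∀ k, MemLp (X k) 2 P) :
    (memLp_sum_mul s a hX).toLp _ = ∑ k ∈ s, a k • (hX k).toLp (X k) := by
  classical
  induction s using Finset.induction_on with
  | empty => simp only [Finset.sum_empty]; exact MemLp.toLp_zero _
  | insert k s hk ih =>
    rw [Finset.sum_insert hk, ← ih, ← MemLp.toLp_const_smul, ← MemLp.toLp_add]
    congr 1
    funext ω
    simp [Finset.sum_insert hk]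

/-- `Y` minus its conditional expectation given the innovations with index in `S`. -/
noncomputable def centredOn (P : Measure Ω) (ε : ℤ → Ω → E) (S : Set ℤ) (Y : Ω → ℝ) : Ω → ℝ :=
  Y - P[Y | sigmaOf ε S]

theorem stronglyMeasurable_centredOn {S T : Set ℤ} (h : S ⊆ T) {Y : Ω → ℝ}
    (hY : StronglyMeasurable[sigmaOf ε T] Y) :
    StronglyMeasurable[sigmaOf ε T] (centredOn P ε S Y) :=
  hY.sub (stronglyMeasurable_condExp.mono (sigmaOf_mono ε h))

theorem abs_centredOn_le {S : Set ℤ} {Y : Ω → ℝ} {B : ℝ} (hB : ∀ ω, |Y ω| ≤ B) :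
    ∀ᵐ ω ∂P, |centredOn P ε S Y ω| ≤ 2 * B := by
  filter_upwards [ae_bdd_abs_condExp_of_ae_bdd_abs (m := sigmaOf ε S) (μ := P)
    (ae_of_all _ hB)] with ω h
  exact (abs_sub _ _).trans (by linarith [hB ω])

theorem memLp_centredOn {S : Set ℤ} {Y : Ω → ℝ} (hY : MemLp Y 2 P) :
    MemLp (centredOn P ε S Y) 2 P :=
  hY.sub (hY.condExp one_le_two)

theorem integral_centredOn (hε : ∀ i, Measurable (ε i)) {S : Set ℤ} {Y : Ω → ℝ}
    (hY : MemLp Y 2 P) : ∫ ω, centredOn P ε S Y ω ∂P = 0 := by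
  simp only [centredOn, Pi.sub_apply]
  rw [integral_sub (hY.integrable one_le_two) integrable_condExp,
    integral_condExp (sigmaOf_le hε S), sub_self]

/-- In `L²`, conditioning on the innovations in `S ∩ (-∞, k]` agrees with conditioning on the whole
past up to `k`. The first form is used because it keeps the centred variable a function of the
innovations in `S`, as independence of blocks requires. -/
theorem toLp_centredOn (hε : ∀ i, Measurable (ε i)) (hi : iIndepFun ε P) {S : Set ℤ} {k : ℤ}
    {Y : Ω → ℝ} (hY : MemLp Y 2 P) (hm : StronglyMeasurable[sigmaOf ε S] Y) :
    (memLp_centredOn (ε := ε) (S := S ∩ Set.Iic k) hY).toLp _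
      = hY.toLp Y - pastProj P hε k (hY.toLp Y) := by
  refine Lp.ext ?_
  filter_upwards [(memLp_centredOn (P := P) (ε := ε) (S := S ∩ Set.Iic k) hY).coeFn_toLp,
    hY.coeFn_toLp, pastProj_toLp hε k hY,
    Lp.coeFn_sub (hY.toLp Y) (pastProj P hε k (hY.toLp Y)),
    condExp_sigmaOf_inter hε hi S (Set.Iic k) hm (hY.integrable one_le_two)] with ω h1 h2 h3 h4 h5
  rw [h1, h4, Pi.sub_apply, h2, h3, h5, centredOn, Pi.sub_apply]

theorem exists_tail_le {u : ℕ → ℝ} (hu0 : ∀ i, 0 ≤ u i) (hu : Summable u) {η : ℝ} (hη : 0 < η) :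
    ∃ m : ℕ, ∀ M, ∑ i ∈ Finset.Ico m M, u i ≤ η := by
  have h := hu.hasSum.tendsto_sum_nat
  obtain ⟨m, hm⟩ := (h.eventually (lt_mem_nhds (show ∑' i, u i - η < ∑' i, u i by linarith))).exists
  refine ⟨m, fun M => ?_⟩
  rcases le_total m M with hM | hM
  · rw [Finset.sum_Ico_eq_sub _ hM]
    linarith [hu.sum_le_tsum (Finset.range M) fun i _ => hu0 i]
  · rw [Finset.Ico_eq_empty_of_le hM, Finset.sum_empty]
    exact hη.le

theorem sum_sq_le_of_abs_le {s : Finset ℕ} {n : ℕ} {a : ℕ → ℝ} {C D : ℝ}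
    (ha : ∀ k ∈ s, |a k| ≤ C / √n) (hD : (s.card : ℝ) ≤ D * n) (hD0 : 0 ≤ D) :
    ∑ k ∈ s, a k ^ 2 ≤ C ^ 2 * D := by
  calc ∑ k ∈ s, a k ^ 2 ≤ ∑ _k ∈ s, (C / √n) ^ 2 := Finset.sum_le_sum fun k hk => by
        rw [← sq_abs]
        exact pow_le_pow_left₀ (abs_nonneg _) (ha k hk) 2
    _ = s.card * (C ^ 2 / n) := by
        rw [Finset.sum_const, nsmul_eq_mul, div_pow, Real.sq_sqrt (Nat.cast_nonneg n)]
    _ ≤ (D * n) * (C ^ 2 / n) := by gcongr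
    _ ≤ C ^ 2 * D := by
        rcases eq_or_ne (n : ℝ) 0 with h | h
        · rw [h]; simp; positivity
        · rw [mul_comm D, mul_assoc, mul_div_assoc', mul_div_cancel₀ _ h, mul_comm]

/-- Weighted sums of a causal process satisfying Hannan's condition are approximated in `L²` by
sums of independent, centred, uniformly small random variables. -/
theorem exists_block_approx (hG : Measurable G) (hε : ∀ i, Measurable (ε i))
    (hi : iIndepFun ε P) (hid : ∀ i j, IdentDistrib (ε i) (ε j) P P)
    (hX : ∀ t, MemLp (causalProcess G ε t) 2 P) (hmean : ∀ t, ∫ ω, causalProcess G ε t ω ∂P = 0)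
    (hu : Summable (hannanCoeff P G ε)) {C η : ℝ} (hC : 0 < C) (hη : 0 < η) :
    ∃ (B : ℝ) (n₀ : ℕ), 0 ≤ B ∧ ∀ n ≥ n₀, ∀ a : ℕ → ℝ, (∀ k ∈ Finset.Icc 1 n, |a k| ≤ C / √n) →
      ∃ (Y : ℕ → Ω → ℝ) (hY : ∀ b, MemLp (Y b) 2 P), (∀ b, Measurable (Y b)) ∧
        (∀ b, ∀ᵐ ω ∂P, |Y b ω| ≤ B / √n) ∧ (∀ b, ∫ ω, Y b ω ∂P = 0) ∧
        (∀ b, IndepFun (fun ω => ∑ i ∈ Finset.range b, Y i ω) (Y b) P) ∧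
        ‖(memLp_sum_mul (Finset.Icc 1 n) a fun k : ℕ => hX k).toLp _
          - ∑ b ∈ Finset.range (n + 1), (hY b).toLp _‖ ≤ η := by
  obtain ⟨m, hm⟩ := exists_tail_le (hannanCoeff_nonneg P G ε) hu
    (show 0 < η / (3 * C) by positivity)
  -- Each of the three error terms gets `η / 3`; using `m + 1` instead of `m` avoids dividing by
  -- zero.
  set δ : ℝ := η / (3 * C) / (m + 1) with hδdef
  have hδ : 0 < δ := by positivity
  obtain ⟨L, B', V, hVm, hVB', hXV⟩ := exists_bounded_approx hG hε hi hid hX hδ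
  set B : ℝ := max B' 1 with hBdef
  have hB1 : 0 < B := lt_of_lt_of_le one_pos (le_max_right _ _)
  have hVB : ∀ k ω, |V k ω| ≤ B := fun k ω => (hVB' k ω).trans (le_max_left _ _)
  have hV : ∀ k, MemLp (V k) 2 P := fun k =>
    MemLp.of_bound ((hVm k).mono (sigmaOf_le hε _)).aestronglyMeasurable B (ae_of_all _ (hVB k))
  -- For `n ≥ N` at most a fraction `2L/N` of the times is discarded, so their squared weights sum
  -- to at most `C² · 2L/N`. This `N` makes that at most `(η / (3(m+1)B))²`.
  obtain ⟨N, hN⟩ := exists_nat_gt (2 * L * (C * (3 * (m + 1) * B / η)) ^ 2)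
  have hN0 : 0 < N := by
    have : (0 : ℝ) ≤ 2 * L * (C * (3 * (m + 1) * B / η)) ^ 2 := by positivity
    exact_mod_cast this.trans_lt hN
  refine ⟨N * (C * (2 * B)), N, by positivity, fun n hn a ha => ?_⟩
  have hn0 : 0 < n := hN0.trans_le hn
  have hn0' : (0 : ℝ) < n := by exact_mod_cast hn0
  let S : ℤ → Set ℤ := fun k => Set.Icc (k - L) k
  let W : ℤ → Ω → ℝ := fun k => centredOn P ε (S k ∩ Set.Iic (k - m)) (V k)
  have hW : ∀ k, MemLp (W k) 2 P := fun k => memLp_centredOn (hV k)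
  have hWm : ∀ k, StronglyMeasurable[sigmaOf ε (S k)] (W k) := fun k =>
    stronglyMeasurable_centredOn Set.inter_subset_left (hVm k)
  -- A window reaches back `L` steps. If `k % N ≥ L`, it stays inside `[N b, N b + N)` with `b = k /
  -- N`, so different blocks use disjoint sets of innovations.
  let kept : Finset ℕ := (Finset.Icc 1 n).filter fun k => L ≤ k % N
  let block : ℕ → Finset ℕ := fun b => kept.filter fun k => k / N = b
  let Y : ℕ → Ω → ℝ := fun b ω => ∑ k ∈ block b, a k * W k ω
  have hY : ∀ b, MemLp (Y b) 2 P := fun b => memLp_sum_mul _ _ fun k : ℕ => hW k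
  have hblock : ∀ b, ∀ k ∈ block b, k ∈ Finset.Icc 1 n ∧ L ≤ k % N ∧ k / N = b := by
    intro b k hk
    simp only [block, kept, Finset.mem_filter] at hk
    exact ⟨hk.1.1, hk.1.2, hk.2⟩
  have hYm : ∀ b : ℕ, StronglyMeasurable[sigmaOf ε (Set.Ico (N * b : ℤ) (N * b + N))] (Y b) := by
    intro b
    refine Finset.stronglyMeasurable_fun_sum _ fun k hk => ?_
    refine stronglyMeasurable_const.mul ((hWm k).mono (sigmaOf_mono ε ?_))
    obtain ⟨-, hL, hb⟩ := hblock b k hk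
    have h1 := Nat.div_add_mod k N
    have h2 := Nat.mod_lt k hN0
    rw [hb] at h1
    intro j hj
    simp only [S, Set.mem_Icc, Set.mem_Ico] at hj ⊢
    zify at h1 h2 hL
    constructor <;> linarith
  refine ⟨Y, hY, fun b => ((hYm b).mono (sigmaOf_le hε _)).measurable, fun b => ?_, fun b => ?_,
    fun b => ?_, ?_⟩
  · have hae : ∀ᵐ ω ∂P, ∀ k : ℕ, |W k ω| ≤ 2 * B :=
      ae_all_iff.2 fun k => abs_centredOn_le (hVB k)
    filter_upwards [hae] with ω hω
    calc |Y b ω| ≤ ∑ k ∈ block b, |a k * W k ω| := Finset.abs_sum_le_sum_abs _ _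
      _ ≤ ∑ _k ∈ block b, C / √n * (2 * B) := Finset.sum_le_sum fun k hk => by
          rw [abs_mul]
          exact mul_le_mul (ha k (hblock b k hk).1) (hω k) (abs_nonneg _) (by positivity)
      _ = (block b).card * (C / √n * (2 * B)) := by rw [Finset.sum_const, nsmul_eq_mul]
      _ ≤ N * (C / √n * (2 * B)) := by
          gcongr
          exact card_filter_div_eq_le hN0 _ _
      _ = N * (C * (2 * B)) / √n := by ring
  · simp only [Y]
    rw [integral_finsetSum _ fun (k : ℕ) _ => ((hW k).integrable one_le_two).const_mul _]
    refine Finset.sum_eq_zero fun k _ => ?_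
    rw [integral_const_mul, integral_centredOn hε (hV k), mul_zero]
  · have h1 : StronglyMeasurable[sigmaOf ε (Set.Iio (N * b : ℤ))]
        (fun ω => ∑ i ∈ Finset.range b, Y i ω) := by
      refine Finset.stronglyMeasurable_fun_sum _ fun i hi => (hYm i).mono (sigmaOf_mono ε ?_)
      intro j hj
      simp only [Set.mem_Ico, Set.mem_Iio] at hj ⊢
      have : N * i + N ≤ N * b := by
        rw [← Nat.mul_succ]
        exact Nat.mul_le_mul_left N (Finset.mem_range.1 hi)
      zify at this
      linarith
    have hdis : Disjoint (Set.Iio (N * b : ℤ)) (Set.Ico (N * b : ℤ) (N * b + N)) := by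
      rw [Set.disjoint_left]
      intro j hj hj'
      exact absurd hj'.1 (not_le.2 hj)
    exact indep_of_indep_of_le_left (indep_of_indep_of_le_right (indep_sigmaOf hε hi hdis)
      (hYm b).measurable.comap_le) h1.measurable.comap_le
  · have e1 : ∑ b ∈ Finset.range (n + 1), (hY b).toLp _ =
        ∑ k ∈ kept, a k • ((hV k).toLp _ - pastProj P hε ((k : ℤ) - m) ((hV k).toLp _)) := by
      have h1 : ∀ b, (hY b).toLp _ = ∑ k ∈ block b,
          a k • ((hV k).toLp _ - pastProj P hε ((k : ℤ) - m) ((hV k).toLp _)) := fun b => by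
        refine (toLp_sum_mul (block b) a fun k : ℕ => hW k).trans ?_
        exact Finset.sum_congr rfl fun k _ => by rw [← toLp_centredOn hε hi (hV k) (hVm k)]
      rw [Finset.sum_congr rfl fun b _ => h1 b]
      -- The crude bound `k / N ≤ n` suffices; superfluous blocks are empty sums.
      refine Finset.sum_fiberwise_of_maps_to (fun k hk => ?_) _
      simp only [kept, Finset.mem_filter, Finset.mem_Icc] at hk
      exact Finset.mem_range.2 (Nat.lt_succ_of_le ((Nat.div_le_self k N).trans hk.1.2))
    rw [e1, toLp_sum_mul]
    refine ((isIncreasingProj_pastProj (P := P) hε).norm_sum_sub_kept_le (Finset.Icc 1 n)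
      (fun k => L ≤ k % N) a (fun k => (hX k).toLp _) (fun k => (hV k).toLp _)
      (fun k => pastProj_causalProcess hG hε hX k)
      (fun k => pastProj_toLp_eq_self hε k (hV k)
        ((hVm k).mono (sigmaOf_mono ε Set.Icc_subset_Iic_self))) m (hannanCoeff P G ε)
      (hannanCoeff_nonneg P G ε)
      (fun i k => (norm_increment_causalProcess hG hε hi hid hX k i).le)
      (fun k => tendsto_norm_pastProj hG hε hi hid hX hmean k) hδ.le hB1.le
      (fun k => ?_) (fun k => norm_toLp_le_of_bound _ hB1.le (hVB k)) hm).trans ?_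
    · rw [← MemLp.toLp_sub]
      exact norm_toLp_le_of_eLpNorm_le _ hδ.le (hXV k)
    · have hA : √(∑ k ∈ Finset.Icc 1 n, a k ^ 2) ≤ C := by
        refine Real.sqrt_le_iff.2 ⟨hC.le, ?_⟩
        have := sum_sq_le_of_abs_le (D := 1) ha (by simp) zero_le_one
        linarith
      have hD : √(∑ k ∈ Finset.Icc 1 n with ¬ L ≤ k % N, a k ^ 2) ≤ η / (3 * (m + 1) * B) := by
        refine Real.sqrt_le_iff.2 ⟨by positivity, ?_⟩
        have hc : (((Finset.Icc 1 n).filter fun k => ¬ L ≤ k % N).card : ℝ) ≤ 2 * L / N * n := by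
          have h1 : (((Finset.Icc 1 n).filter fun k => ¬ L ≤ k % N).card : ℝ) ≤
              L * ((n / N : ℕ) + 1) := by
            exact_mod_cast card_filter_mod_lt_le N n L
          have h2 : ((n / N : ℕ) : ℝ) ≤ n / N := Nat.cast_div_le
          have h3 : (1 : ℝ) ≤ n / N := by
            rw [le_div_iff₀ (by exact_mod_cast hN0), one_mul]
            exact_mod_cast hn
          calc _ ≤ (L : ℝ) * ((n / N : ℕ) + 1) := h1
            _ ≤ L * (n / N + n / N) := by gcongr
            _ = 2 * L / N * n := by ring
        refine (sum_sq_le_of_abs_le (fun k hk => ha k (Finset.mem_filter.1 hk).1) hc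
          (by positivity)).trans ?_
        have hN' : (0 : ℝ) < N := by exact_mod_cast hN0
        rw [mul_div_assoc', div_le_iff₀ hN']
        have h4 := mul_le_mul_of_nonneg_left hN.le (sq_nonneg (η / (3 * (m + 1) * B)))
        refine le_trans (le_of_eq ?_) h4
        field_simp
      have hmB : (m : ℝ) ≤ m + 1 := by linarith
      calc _ ≤ η / (3 * C) * C + (m + 1) * δ * C + (m + 1) * B * (η / (3 * (m + 1) * B)) := by
            gcongr
        _ = η := by
            rw [hδdef]
            field_simp
            ring

end Blocks

/-! ### Characteristic functions: expansion, telescoping over blocks, and the central limit theorem.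
-/

section CharFun

set_option linter.unusedSectionVars false

variable {Ω E : Type*} [mΩ : MeasurableSpace Ω] [mE : MeasurableSpace E]
  {P : Measure Ω} [IsProbabilityMeasure P]

theorem abs_exp_neg_sub_exp_neg_le {a b : ℝ} (ha : 0 ≤ a) (hb : 0 ≤ b) :
    |Real.exp (-a) - Real.exp (-b)| ≤ |a - b| := by
  have key : ∀ x y : ℝ, 0 ≤ x → Real.exp (-x) - Real.exp (-y) ≤ |x - y| := by
    intro x y hx
    have h1 : Real.exp (-y) = Real.exp (-x) * Real.exp (x - y) := by
      rw [← Real.exp_add]; congr 1; ring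
    have h2 := Real.add_one_le_exp (x - y)
    have h3 : Real.exp (-x) ≤ 1 := Real.exp_le_one_iff.2 (by linarith)
    rw [h1]
    calc Real.exp (-x) - Real.exp (-x) * Real.exp (x - y)
        = Real.exp (-x) * (1 - Real.exp (x - y)) := by ring
      _ ≤ Real.exp (-x) * |x - y| := by
          refine mul_le_mul_of_nonneg_left ?_ (Real.exp_pos _).le
          linarith [neg_abs_le (x - y)]
      _ ≤ 1 * |x - y| := mul_le_mul_of_nonneg_right h3 (abs_nonneg _)
      _ = |x - y| := one_mul _
  refine abs_le.2 ⟨?_, key a b ha⟩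
  have := key b a hb
  rw [abs_sub_comm] at this
  linarith

theorem charFun_map_eq_integral {f : Ω → ℝ} (hf : AEMeasurable f P) (t : ℝ) :
    charFun (P.map f) t = ∫ ω, Complex.exp (t * f ω * Complex.I) ∂P := by
  rw [charFun_apply_real, integral_map hf (by fun_prop)]

/-- From `|e^{iu} - 1| ≤ |u|` and the `L¹`–`L²` inequality; this transfers the block approximation
to characteristic functions. -/
theorem norm_charFun_sub_le {f g : Ω → ℝ} (hf : MemLp f 2 P) (hg : MemLp g 2 P) (t : ℝ) :
    ‖charFun (P.map f) t - charFun (P.map g) t‖ ≤ |t| * ‖hf.toLp f - hg.toLp g‖ := by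
  have hi : ∀ {h : Ω → ℝ}, AEMeasurable h P →
      Integrable (fun ω => Complex.exp (t * h ω * Complex.I)) P := by
    intro h hh
    refine Integrable.of_bound (by fun_prop) 1 (ae_of_all _ fun ω => ?_)
    rw [← Complex.ofReal_mul, Complex.norm_exp_ofReal_mul_I]
  have hfm := hf.aestronglyMeasurable.aemeasurable
  have hgm := hg.aestronglyMeasurable.aemeasurable
  rw [charFun_map_eq_integral hfm, charFun_map_eq_integral hgm,
    ← integral_sub (hi hfm) (hi hgm), ← MemLp.toLp_sub]
  have habs : MemLp (fun ω => |f ω - g ω|) 2 P := (hf.sub hg).abs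
  have hnorm : ‖habs.toLp _‖ = ‖(hf.sub hg).toLp _‖ := by
    refine (pow_left_inj₀ (norm_nonneg _) (norm_nonneg _) two_ne_zero).1 ?_
    rw [norm_toLp_sq, norm_toLp_sq]
    simp [sq_abs]
  rw [← hnorm]
  calc ‖∫ ω, (Complex.exp (t * f ω * Complex.I) - Complex.exp (t * g ω * Complex.I)) ∂P‖
      ≤ ∫ ω, |t| * |f ω - g ω| ∂P := by
        refine norm_integral_le_of_norm_le ((habs.integrable one_le_two).const_mul _)
          (ae_of_all _ fun ω => ?_)
        have e : Complex.exp (t * f ω * Complex.I) - Complex.exp (t * g ω * Complex.I) =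
            Complex.exp (((t * g ω : ℝ) : ℂ) * Complex.I) *
              (Complex.exp (Complex.I * ((t * (f ω - g ω) : ℝ) : ℂ)) - 1) := by
          rw [mul_sub, mul_one, ← Complex.exp_add]
          congr 2 <;> push_cast <;> ring
        rw [e, norm_mul, Complex.norm_exp_ofReal_mul_I, one_mul, ← abs_mul]
        exact Real.norm_exp_I_mul_ofReal_sub_one_le
    _ = |t| * ∫ ω, |f ω - g ω| ∂P := integral_const_mul _ _
    _ ≤ |t| * ‖habs.toLp _‖ :=
        mul_le_mul_of_nonneg_left ((le_abs_self _).trans (abs_integral_le_norm_toLp habs))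
          (abs_nonneg _)

theorem norm_exp_mul_I_sub_le {x : ℝ} (hx : |x| ≤ 1) :
    ‖Complex.exp (x * Complex.I) - (1 + x * Complex.I - x ^ 2 / 2)‖ ≤ |x| ^ 3 := by
  have hn : ‖(x : ℂ) * Complex.I‖ = |x| := by simp
  have h := Complex.exp_bound (x := x * Complex.I) (by rw [hn]; exact hx) (n := 3) (by norm_num)
  rw [hn] at h
  simp only [Finset.sum_range_succ, Finset.sum_range_zero, zero_add, pow_zero, pow_one,
    Nat.factorial, mul_pow, Complex.I_sq] at h
  norm_num at h
  have e : Complex.exp (x * Complex.I) - (1 + x * Complex.I - x ^ 2 / 2) =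
      Complex.exp (x * Complex.I) - (1 + x * Complex.I + -(x : ℂ) ^ 2 / 2) := by ring
  rw [e]
  refine h.trans ?_
  have : 0 ≤ |x| ^ 3 := by positivity
  linarith

/-- Both sides are compared with `1 - t² E Y² / 2`: Taylor's formula for a centred bounded variable
on one side, the expansion of the real exponential on the other. Each costs `(|t| M)³`. -/
theorem norm_charFun_sub_exp_le {Y : Ω → ℝ} (hY : MemLp Y 2 P) {M : ℝ}
    (hM : ∀ᵐ ω ∂P, |Y ω| ≤ M) (h0 : ∫ ω, Y ω ∂P = 0) {t : ℝ} (ht : |t| * M ≤ 1) :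
    ‖charFun (P.map Y) t - (Real.exp (-(t ^ 2 * (∫ ω, Y ω ^ 2 ∂P) / 2)) : ℝ)‖
      ≤ 2 * (|t| * M) ^ 3 := by
  have hM0 : 0 ≤ M := by
    obtain ⟨ω, hω⟩ := hM.exists
    exact (abs_nonneg _).trans hω
  set v := ∫ ω, Y ω ^ 2 ∂P with hv
  have hv0 : 0 ≤ v := integral_nonneg fun _ => sq_nonneg _
  have hYm := hY.aestronglyMeasurable.aemeasurable
  have hvM : v ≤ M ^ 2 := by
    calc v ≤ ∫ _, M ^ 2 ∂P := integral_mono_ae hY.integrable_sq (integrable_const _)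
          (hM.mono fun ω hω => by
            simp only
            rw [← sq_abs]; exact pow_le_pow_left₀ (abs_nonneg _) hω 2)
      _ = M ^ 2 := by simp
  have htM : 0 ≤ |t| * M := by positivity
  have h1 : ‖charFun (P.map Y) t - ((1 - t ^ 2 * v / 2 : ℝ) : ℂ)‖ ≤ (|t| * M) ^ 3 := by
    have hexp : Integrable (fun ω => Complex.exp (t * Y ω * Complex.I)) P := by
      refine Integrable.of_bound (by fun_prop) 1 (ae_of_all _ fun ω => ?_)
      rw [← Complex.ofReal_mul, Complex.norm_exp_ofReal_mul_I]
    have hi1 : Integrable (fun ω => (Y ω : ℂ)) P := (hY.integrable one_le_two).ofReal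
    have hi2 : Integrable (fun ω => ((Y ω ^ 2 : ℝ) : ℂ)) P := hY.integrable_sq.ofReal
    have hi0 : Integrable (fun ω => (1 : ℂ) + t * Complex.I * (Y ω : ℂ)) P :=
      (integrable_const _).add (hi1.const_mul _)
    have hi3 : Integrable (fun ω => (1 : ℂ) + t * Complex.I * (Y ω : ℂ)
        - t ^ 2 / 2 * ((Y ω ^ 2 : ℝ) : ℂ)) P := hi0.sub (hi2.const_mul _)
    have e : ((1 - t ^ 2 * v / 2 : ℝ) : ℂ) = ∫ ω, ((1 : ℂ) + t * Complex.I * (Y ω : ℂ)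
        - t ^ 2 / 2 * ((Y ω ^ 2 : ℝ) : ℂ)) ∂P := by
      rw [integral_sub hi0 (hi2.const_mul _),
        integral_add (integrable_const _) (hi1.const_mul _), integral_const_mul,
        integral_const_mul, integral_complex_ofReal, integral_complex_ofReal, h0, ← hv]
      simp
      ring
    rw [charFun_map_eq_integral hYm, e, ← integral_sub hexp hi3]
    refine (norm_integral_le_of_norm_le_const (C := (|t| * M) ^ 3)
      (hM.mono fun ω hω => ?_)).trans (by simp)
    have hx : |t * Y ω| ≤ |t| * M := by rw [abs_mul]; gcongr
    have h := norm_exp_mul_I_sub_le (hx.trans ht)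
    refine le_trans (le_of_eq ?_) (h.trans (pow_le_pow_left₀ (abs_nonneg _) hx 3))
    congr 1
    push_cast
    ring
  have h2 : |(1 - t ^ 2 * v / 2) - Real.exp (-(t ^ 2 * v / 2))| ≤ (|t| * M) ^ 3 := by
    have hs0 : 0 ≤ t ^ 2 * v / 2 := by positivity
    have hs : t ^ 2 * v / 2 ≤ (|t| * M) ^ 2 / 2 := by
      rw [mul_pow, sq_abs]
      gcongr
    have hs1 : (|t| * M) ^ 2 ≤ 1 := pow_le_one₀ htM ht
    have h := Real.abs_exp_sub_one_sub_id_le (x := -(t ^ 2 * v / 2))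
      (by rw [abs_neg, abs_of_nonneg hs0]; linarith)
    rw [abs_sub_comm]
    have e : Real.exp (-(t ^ 2 * v / 2)) - (1 - t ^ 2 * v / 2) =
      Real.exp (-(t ^ 2 * v / 2)) - 1 - -(t ^ 2 * v / 2) := by ring
    rw [e]
    refine h.trans ?_
    have hp : (t ^ 2 * v / 2) ^ 2 ≤ ((|t| * M) ^ 2 / 2) ^ 2 := pow_le_pow_left₀ hs0 hs 2
    have hq : (|t| * M) ^ 4 ≤ (|t| * M) ^ 3 := pow_le_pow_of_le_one htM ht (by norm_num)
    have : 0 ≤ (|t| * M) ^ 4 := by positivity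
    nlinarith
  calc _ = ‖(charFun (P.map Y) t - ((1 - t ^ 2 * v / 2 : ℝ) : ℂ)) +
        (((1 - t ^ 2 * v / 2) - Real.exp (-(t ^ 2 * v / 2)) : ℝ) : ℂ)‖ := by
          congr 1; push_cast; ring
    _ ≤ (|t| * M) ^ 3 + (|t| * M) ^ 3 := by
        refine (norm_add_le _ _).trans (add_le_add h1 ?_)
        rw [Complex.norm_real]
        exact h2
    _ = _ := by ring

/-- Lindeberg-style telescoping: both expressions are multiplicative when a summand is added and all
factors have modulus at most 1, so the one-step errors add up. -/
theorem norm_charFun_sum_sub_exp_le {Y : ℕ → Ω → ℝ} (hY : ∀ b, MemLp (Y b) 2 P)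
    (hYm : ∀ b, Measurable (Y b)) {M : ℝ} (hM : ∀ b, ∀ᵐ ω ∂P, |Y b ω| ≤ M)
    (h0 : ∀ b, ∫ ω, Y b ω ∂P = 0)
    (hind : ∀ b, IndepFun (fun ω => ∑ i ∈ Finset.range b, Y i ω) (Y b) P)
    {t : ℝ} (ht : |t| * M ≤ 1) (n : ℕ) :
    ‖charFun (P.map fun ω => ∑ i ∈ Finset.range n, Y i ω) t
      - (Real.exp (-(t ^ 2 * (∫ ω, (∑ i ∈ Finset.range n, Y i ω) ^ 2 ∂P) / 2)) : ℝ)‖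
      ≤ n * (2 * (|t| * M) ^ 3) := by
  have hSL : ∀ n, MemLp (fun ω => ∑ i ∈ Finset.range n, Y i ω) 2 P := fun n =>
    memLp_finsetSum _ fun i _ => hY i
  induction n with
  | zero => simp
  | succ n ih =>
    set S : Ω → ℝ := fun ω => ∑ i ∈ Finset.range n, Y i ω with hS
    have e : (fun ω => ∑ i ∈ Finset.range (n + 1), Y i ω) = S + Y n := by
      funext ω; simp [hS, Finset.sum_range_succ]
    have hSm : Measurable S := Finset.measurable_fun_sum _ fun i _ => hYm i
    have hv : ∫ ω, (∑ i ∈ Finset.range (n + 1), Y i ω) ^ 2 ∂P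
        = ∫ ω, S ω ^ 2 ∂P + ∫ ω, Y n ω ^ 2 ∂P := by
      have hSY : Integrable (fun ω => S ω * Y n ω) P := (hSL n).integrable_mul (hY n)
      have hSY0 : ∫ ω, S ω * Y n ω ∂P = 0 := by
        rw [(hind n).integral_fun_mul_eq_mul_integral hSm.aestronglyMeasurable
          (hYm n).aestronglyMeasurable, h0, mul_zero]
      have e2 : ∀ ω, (∑ i ∈ Finset.range (n + 1), Y i ω) ^ 2
          = S ω ^ 2 + 2 * (S ω * Y n ω) + Y n ω ^ 2 := fun ω => by
        rw [Finset.sum_range_succ]; simp only [hS]; ring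
      simp_rw [e2]
      have hSsq : Integrable (fun ω => S ω ^ 2) P := (hSL n).integrable_sq
      have hsum : Integrable (fun ω => S ω ^ 2 + 2 * (S ω * Y n ω)) P :=
        hSsq.add (hSY.const_mul 2)
      rw [integral_add hsum (hY n).integrable_sq, integral_add hSsq (hSY.const_mul 2), integral_const_mul, hSY0, mul_zero,
        add_zero]
    have hprod : charFun (P.map (S + Y n)) t = charFun (P.map S) t * charFun (P.map (Y n)) t := by
      rw [(hind n).charFun_map_add_eq_mul hSm.aemeasurable (hYm n).aemeasurable, Pi.mul_apply]
    rw [hv, e, hprod]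
    set vS := ∫ ω, S ω ^ 2 ∂P
    set vY := ∫ ω, Y n ω ^ 2 ∂P with hvY
    have hexp : ((Real.exp (-(t ^ 2 * (vS + vY) / 2)) : ℝ) : ℂ) =
        (Real.exp (-(t ^ 2 * vS / 2)) : ℝ) * (Real.exp (-(t ^ 2 * vY / 2)) : ℝ) := by
      rw [← Complex.ofReal_mul, ← Real.exp_add]
      congr 2; ring
    have h1 := norm_charFun_sub_exp_le (hY n) (hM n) (h0 n) ht
    rw [← hvY] at h1
    have hcf : ‖charFun (P.map (Y n)) t‖ ≤ 1 := by
      have : IsProbabilityMeasure (P.map (Y n)) :=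
        Measure.isProbabilityMeasure_map (hYm n).aemeasurable
      exact norm_charFun_le_one t
    have hex : ‖((Real.exp (-(t ^ 2 * vS / 2)) : ℝ) : ℂ)‖ ≤ 1 := by
      rw [Complex.norm_real, Real.norm_eq_abs, abs_of_pos (Real.exp_pos _), Real.exp_le_one_iff]
      have : 0 ≤ vS := integral_nonneg fun _ => sq_nonneg _
      have : 0 ≤ t ^ 2 * vS / 2 := by positivity
      linarith
    rw [hexp]
    set A := charFun (P.map S) t
    set B := charFun (P.map (Y n)) t
    set A' := ((Real.exp (-(t ^ 2 * vS / 2)) : ℝ) : ℂ)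
    set B' := ((Real.exp (-(t ^ 2 * vY / 2)) : ℝ) : ℂ)
    calc ‖A * B - A' * B'‖ = ‖(A - A') * B + A' * (B - B')‖ := by congr 1; ring
      _ ≤ ‖A - A'‖ * ‖B‖ + ‖A'‖ * ‖B - B'‖ := by
          refine (norm_add_le _ _).trans ?_
          rw [norm_mul, norm_mul]
      _ ≤ n * (2 * (|t| * M) ^ 3) * 1 + 1 * (2 * (|t| * M) ^ 3) := by
          refine add_le_add ?_ ?_
          · exact mul_le_mul ih hcf (norm_nonneg _) ((norm_nonneg _).trans ih)
          · exact mul_le_mul hex h1 (norm_nonneg _) zero_le_one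
      _ = _ := by push_cast; ring

variable {ε : ℤ → Ω → E} {G : (ℕ → E) → ℝ}

/-- Central limit theorem for weighted sums of a causal process, in terms of characteristic
functions. -/
theorem tendsto_charFun_weighted_sum (hG : Measurable G) (hε : ∀ i, Measurable (ε i))
    (hi : iIndepFun ε P) (hid : ∀ i j, IdentDistrib (ε i) (ε j) P P)
    (hX : ∀ t, MemLp (causalProcess G ε t) 2 P) (hmean : ∀ t, ∫ ω, causalProcess G ε t ω ∂P = 0)
    (hu : Summable (hannanCoeff P G ε)) {C : ℝ} (hC : 0 < C) {n : ℕ → ℕ}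
    (hn : Tendsto n atTop atTop) (a : ℕ → ℕ → ℝ)
    (ha : ∀ i, ∀ k ∈ Finset.Icc 1 (n i), |a i k| ≤ C / √(n i))
    (hvar : Tendsto (fun i => ∫ ω,
      (∑ k ∈ Finset.Icc 1 (n i), a i k * causalProcess G ε (k : ℕ) ω) ^ 2 ∂P) atTop (𝓝 1))
    (t : ℝ) :
    Tendsto (fun i => charFun (P.map fun ω =>
      ∑ k ∈ Finset.Icc 1 (n i), a i k * causalProcess G ε (k : ℕ) ω) t) atTop
      (𝓝 ((Real.exp (-(t ^ 2 / 2)) : ℝ) : ℂ)) := by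
  have hT : ∀ i, MemLp (fun ω => ∑ k ∈ Finset.Icc 1 (n i), a i k * causalProcess G ε (k : ℕ) ω)
      2 P := fun i => memLp_sum_mul _ _ fun k : ℕ => hX k
  rw [Metric.tendsto_atTop]
  intro γ hγ
  -- Replacing the sum by blocks costs `|t| η` in the characteristic function and up to `5η · t²/2`
  -- through the change of variance. The constant 5 bounds the sum of the two norms, given norm at
  -- most 2 and `η ≤ 1`.
  set η : ℝ := min 1 (γ / (4 * (|t| + 5 * t ^ 2 / 2 + 1))) with hηdef
  have hη : 0 < η := lt_min one_pos (by positivity)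
  have hη1 : η ≤ 1 := min_le_left _ _
  have hηγ : η * (|t| + 5 * t ^ 2 / 2) ≤ γ / 4 := by
    have h1 : η ≤ γ / (4 * (|t| + 5 * t ^ 2 / 2 + 1)) := min_le_right _ _
    have h2 : 0 ≤ |t| + 5 * t ^ 2 / 2 := by positivity
    calc η * (|t| + 5 * t ^ 2 / 2) ≤ η * (|t| + 5 * t ^ 2 / 2 + 1) :=
          mul_le_mul_of_nonneg_left (by linarith) hη.le
      _ ≤ γ / (4 * (|t| + 5 * t ^ 2 / 2 + 1)) * (|t| + 5 * t ^ 2 / 2 + 1) := by gcongr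
      _ = γ / 4 := by field_simp
  obtain ⟨B, n₀, hB, hblock⟩ := exists_block_approx hG hε hi hid hX hmean hu hC hη
  have hsq : Tendsto (fun i => √(n i : ℝ)) atTop atTop :=
    Real.tendsto_sqrt_atTop.comp (tendsto_natCast_atTop_atTop.comp hn)
  have hsmall : Tendsto (fun i => |t| * (B / √(n i))) atTop (𝓝 0) := by
    have := (hsq.const_div_atTop B).const_mul |t|
    simpa using this
  -- There are `n + 1` blocks, each with error of order `n^{-3/2}`.
  have herr : Tendsto (fun i => ((n i + 1 : ℕ) : ℝ) * (2 * (|t| * (B / √(n i))) ^ 3)) atTop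
      (𝓝 0) := by
    have h1 : Tendsto (fun i => 4 * (|t| * B) ^ 3 / √(n i)) atTop (𝓝 0) := hsq.const_div_atTop _
    refine squeeze_zero' (Eventually.of_forall fun i => by positivity) ?_ h1
    filter_upwards [hn.eventually_ge_atTop 1] with i hi
    have hpos : (0 : ℝ) < n i := by exact_mod_cast hi
    have hs : 0 < √(n i : ℝ) := Real.sqrt_pos.2 hpos
    have hss : √(n i : ℝ) ^ 2 = n i := Real.sq_sqrt hpos.le
    have h2 : ((n i + 1 : ℕ) : ℝ) ≤ 2 * √(n i : ℝ) ^ 2 := by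
      rw [hss]; push_cast
      have : (1 : ℝ) ≤ n i := by exact_mod_cast hi
      linarith
    calc ((n i + 1 : ℕ) : ℝ) * (2 * (|t| * (B / √(n i))) ^ 3)
        ≤ (2 * √(n i : ℝ) ^ 2) * (2 * (|t| * (B / √(n i))) ^ 3) := by gcongr
      _ = 4 * (|t| * B) ^ 3 / √(n i) := by field_simp; ring
  have hv := (hvar.sub_const 1).abs.const_mul (t ^ 2 / 2)
  simp only [sub_self, abs_zero, mul_zero] at hv
  obtain ⟨i₀, hi₀⟩ := eventually_atTop.1 ((hn.eventually_ge_atTop n₀).and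
    ((hsmall.eventually (gt_mem_nhds one_pos)).and
    ((herr.eventually (gt_mem_nhds (show 0 < γ / 4 by linarith))).and
    ((hv.eventually (gt_mem_nhds (show 0 < γ / 4 by linarith))).and
    (hvar.eventually (gt_mem_nhds (show (1 : ℝ) < 4 by norm_num)))))))
  refine ⟨i₀, fun i hi' => ?_⟩
  obtain ⟨h1, h2, h3, h4, h5⟩ := hi₀ i hi'
  obtain ⟨Y, hYL, hYm, hYb, hY0, hYind, hYapp⟩ := hblock (n i) h1 (a i) (ha i)
  have hSL : MemLp (fun ω => ∑ b ∈ Finset.range (n i + 1), Y b ω) 2 P :=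
    memLp_finsetSum _ fun b _ => hYL b
  have hSe : hSL.toLp _ = ∑ b ∈ Finset.range (n i + 1), (hYL b).toLp _ := by
    have h := toLp_sum_mul (Finset.range (n i + 1)) (fun _ => 1) hYL
    simp only [one_smul] at h
    rw [← h]
    simp only [one_mul]
  rw [← hSe] at hYapp
  have hcf := norm_charFun_sub_le (hT i) hSL t
  have hcl := norm_charFun_sum_sub_exp_le hYL hYm hYb hY0 hYind h2.le (n i + 1)
  rw [← norm_toLp_sq hSL] at hcl
  rw [← norm_toLp_sq (hT i)] at h4 h5
  set x := (hT i).toLp _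
  set y := hSL.toLp _
  have hx2 : ‖x‖ ≤ 2 := by nlinarith [norm_nonneg x]
  have hxy : |‖y‖ - ‖x‖| ≤ η := by
    rw [abs_sub_comm]; exact (abs_norm_sub_norm_le x y).trans hYapp
  have hvv : |‖y‖ ^ 2 - ‖x‖ ^ 2| ≤ 5 * η := by
    have h6 : ‖y‖ + ‖x‖ ≤ 5 := by linarith [(abs_le.1 hxy).2]
    rw [sq_sub_sq, abs_mul, abs_of_nonneg (a := ‖y‖ + ‖x‖) (by positivity)]
    exact mul_le_mul h6 hxy (abs_nonneg _) (by norm_num)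
  have hexp : ‖((Real.exp (-(t ^ 2 * ‖y‖ ^ 2 / 2)) : ℝ) : ℂ) - (Real.exp (-(t ^ 2 / 2)) : ℝ)‖
      ≤ t ^ 2 / 2 * (5 * η) + t ^ 2 / 2 * |‖x‖ ^ 2 - 1| := by
    rw [← Complex.ofReal_sub, Complex.norm_real, Real.norm_eq_abs]
    refine (abs_exp_neg_sub_exp_neg_le (by positivity) (by positivity)).trans ?_
    have e : t ^ 2 * ‖y‖ ^ 2 / 2 - t ^ 2 / 2 = t ^ 2 / 2 * ((‖y‖ ^ 2 - ‖x‖ ^ 2) + (‖x‖ ^ 2 - 1)) := by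
      ring
    rw [e, abs_mul, abs_of_nonneg (a := t ^ 2 / 2) (by positivity), ← mul_add]
    gcongr
    exact (abs_add_le _ _).trans (add_le_add hvv le_rfl)
  rw [dist_eq_norm]
  have htri := norm_add₃_le (a := charFun (P.map fun ω =>
      ∑ k ∈ Finset.Icc 1 (n i), a i k * causalProcess G ε (k : ℕ) ω) t
        - charFun (P.map fun ω => ∑ b ∈ Finset.range (n i + 1), Y b ω) t)
    (b := charFun (P.map fun ω => ∑ b ∈ Finset.range (n i + 1), Y b ω) t
      - (Real.exp (-(t ^ 2 * ‖y‖ ^ 2 / 2)) : ℝ))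
    (c := (Real.exp (-(t ^ 2 * ‖y‖ ^ 2 / 2)) : ℝ) - ((Real.exp (-(t ^ 2 / 2)) : ℝ) : ℂ))
  simp only [sub_add_sub_cancel] at htri
  have h7 : |t| * ‖x - y‖ ≤ |t| * η := mul_le_mul_of_nonneg_left hYapp (abs_nonneg _)
  calc _ ≤ _ := htri
    _ ≤ |t| * η + γ / 4 + (t ^ 2 / 2 * (5 * η) + γ / 4) := by
        refine add_le_add (add_le_add (hcf.trans h7) (hcl.trans h3.le)) (hexp.trans ?_)
        linarith
    _ = η * (|t| + 5 * t ^ 2 / 2) + γ / 2 := by ring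
    _ < γ := by linarith

end CharFun

/-! ### From characteristic functions to distribution functions at moving arguments. -/

section Cdf

theorem gaussianPDF_standard_le_one (x : ℝ) : gaussianPDF 0 1 x ≤ 1 := by
  rw [gaussianPDF, ← ENNReal.ofReal_one]
  refine ENNReal.ofReal_le_ofReal ?_
  rw [gaussianPDFReal]
  have h1 : (√(2 * Real.pi * ((1 : NNReal) : ℝ)))⁻¹ ≤ 1 := by
    refine inv_le_one_of_one_le₀ (Real.one_le_sqrt.2 ?_)
    have := Real.pi_gt_three
    simp only [NNReal.coe_one]
    linarith
  refine mul_le_one₀ h1 (Real.exp_pos _).le (Real.exp_le_one_iff.2 ?_)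
  simp only [NNReal.coe_one]
  have := sq_nonneg (x - 0)
  rw [neg_div]
  have : 0 ≤ (x - 0) ^ 2 / (2 * 1) := by positivity
  linarith

theorem gaussianReal_Iic_add_le (x : ℝ) {δ : ℝ} (hδ : 0 ≤ δ) :
    gaussianReal 0 1 (Set.Iic (x + δ)) ≤ gaussianReal 0 1 (Set.Iic x) + ENNReal.ofReal δ := by
  rw [← Set.Iic_union_Ioc_eq_Iic (show x ≤ x + δ by linarith)]
  refine (measure_union_le _ _).trans (add_le_add le_rfl ?_)
  rw [gaussianReal_apply 0 one_ne_zero]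
  calc ∫⁻ y in Set.Ioc x (x + δ), gaussianPDF 0 1 y ≤ ∫⁻ _ in Set.Ioc x (x + δ), 1 :=
        lintegral_mono fun y => gaussianPDF_standard_le_one y
    _ = ENNReal.ofReal δ := by simp

theorem thickening_Iic_subset (x δ : ℝ) :
    Metric.thickening δ (Set.Iic x) ⊆ Set.Iic (x + δ) := by
  intro y hy
  obtain ⟨z, hz, hd⟩ := Metric.mem_thickening_iff.1 hy
  rw [Real.dist_eq] at hd
  simp only [Set.mem_Iic] at hz ⊢
  linarith [(abs_lt.1 hd).2]

/-- Convergence of characteristic functions to the one of the standard normal law implies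
convergence of distribution functions along every sequence of arguments. -/
theorem tendsto_cdf_sub_of_tendsto_charFun {Ω : Type*} [MeasurableSpace Ω] {P : Measure Ω}
    [IsProbabilityMeasure P] {T : ℕ → Ω → ℝ} (hT : ∀ i, AEMeasurable (T i) P)
    (h : ∀ t : ℝ, Tendsto (fun i => charFun (P.map (T i)) t) atTop
      (𝓝 ((Real.exp (-(t ^ 2 / 2)) : ℝ) : ℂ))) (x : ℕ → ℝ) :
    Tendsto (fun i => |P.real {ω | T i ω ≤ x i} - cdf (gaussianReal 0 1) (x i)|) atTop (𝓝 0) := by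
  let μ : ℕ → ProbabilityMeasure ℝ := fun i =>
    ⟨P.map (T i), Measure.isProbabilityMeasure_map (hT i)⟩
  let γ : ProbabilityMeasure ℝ := ⟨gaussianReal 0 1, inferInstance⟩
  have hw : Tendsto μ atTop (𝓝 γ) := by
    refine ProbabilityMeasure.tendsto_of_tendsto_charFun fun t => ?_
    have e : charFun (γ : Measure ℝ) t = ((Real.exp (-(t ^ 2 / 2)) : ℝ) : ℂ) := by
      change charFun (gaussianReal 0 1) t = _
      rw [charFun_gaussianReal]
      push_cast
      congr 1
      simp
    rw [e]
    exact h t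
  -- One bound on the Lévy–Prokhorov distance controls every half-line at once, so the argument `x
  -- i` may vary with `i`. Thickening a half-line moves its endpoint, and the Gaussian density bound
  -- 1 pays for that.
  have hLP := (LevyProkhorov.continuous_ofMeasure_probabilityMeasure.tendsto γ).comp hw
  rw [Metric.tendsto_atTop]
  intro δ hδ
  have hδ3 : 0 < δ / 3 := by linarith
  obtain ⟨i₀, hi₀⟩ := Metric.tendsto_atTop.1 hLP (δ / 3) hδ3
  refine ⟨i₀, fun i hi => ?_⟩
  have hd := hi₀ i hi
  rw [Function.comp_apply, LevyProkhorov.dist_probabilityMeasure_def, levyProkhorovDist,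
    ← ENNReal.lt_ofReal_iff_toReal_lt (levyProkhorovEDist_ne_top _ _)] at hd
  have hPm : P {ω | T i ω ≤ x i} = (P.map (T i)) (Set.Iic (x i)) :=
    (Measure.map_apply_of_aemeasurable (hT i) measurableSet_Iic).symm
  have h1 : P {ω | T i ω ≤ x i} ≤
      gaussianReal 0 1 (Set.Iic (x i)) + ENNReal.ofReal (δ / 3) + ENNReal.ofReal (δ / 3) := by
    rw [hPm]
    refine (left_measure_le_of_levyProkhorovEDist_lt hd measurableSet_Iic).trans
      (add_le_add ?_ le_rfl)
    rw [ENNReal.toReal_ofReal hδ3.le]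
    exact (measure_mono (thickening_Iic_subset _ _)).trans (gaussianReal_Iic_add_le _ hδ3.le)
  have h2 : gaussianReal 0 1 (Set.Iic (x i)) ≤
      P {ω | T i ω ≤ x i} + ENNReal.ofReal (δ / 3) + ENNReal.ofReal (δ / 3) := by
    -- Starting from `x i - δ / 3` makes the thickened half-line end exactly at `x i`.
    have h3 := gaussianReal_Iic_add_le (x i - δ / 3) hδ3.le
    rw [sub_add_cancel] at h3
    refine h3.trans (add_le_add ?_ le_rfl)
    rw [hPm]
    refine (right_measure_le_of_levyProkhorovEDist_lt hd measurableSet_Iic).trans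
      (add_le_add ?_ le_rfl)
    rw [ENNReal.toReal_ofReal hδ3.le]
    refine measure_mono ((thickening_Iic_subset _ _).trans ?_)
    rw [sub_add_cancel]
  have hfin : ∀ {a b : ℝ≥0∞}, b ≠ ∞ →
      a ≤ b + ENNReal.ofReal (δ / 3) + ENNReal.ofReal (δ / 3) →
      a.toReal ≤ b.toReal + δ / 3 + δ / 3 := by
    intro a b hb hab
    have := ENNReal.toReal_mono (by finiteness) hab
    rwa [ENNReal.toReal_add (by finiteness) (by finiteness),
      ENNReal.toReal_add hb (by finiteness), ENNReal.toReal_ofReal hδ3.le] at this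
  have h1' := hfin (measure_ne_top _ _) h1
  have h2' := hfin (measure_ne_top _ _) h2
  rw [dist_zero_right, norm_abs_eq_norm, Real.norm_eq_abs, cdf_eq_real, measureReal_def,
    measureReal_def, abs_lt]
  constructor <;> linarith

end Cdf

/-! ### Discrete orthogonality, boundary errors and the spectral density. -/

section Trigonometry

theorem sum_cos_eq_zero {n : ℕ} (hn : 0 < n) {s : ℤ} (hs : ¬ (n : ℤ) ∣ s) (γ : ℝ) :
    ∑ k ∈ Finset.Icc 1 n, Real.cos ((k : ℝ) * (2 * Real.pi * s / n) + γ) = 0 := by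
  set z : ℂ := Complex.exp (2 * Real.pi * Complex.I * (s / n)) with hz
  have hn0 : (n : ℂ) ≠ 0 := by exact_mod_cast hn.ne'
  have hzn : z ^ n = 1 := by
    rw [hz, ← Complex.exp_nat_mul, Complex.exp_eq_one_iff]
    exact ⟨s, by field_simp⟩
  have hz1 : z ≠ 1 := by
    intro h
    rw [hz, Complex.exp_eq_one_iff] at h
    obtain ⟨q, hq⟩ := h
    refine hs ⟨q, ?_⟩
    have h2 : (2 * Real.pi * Complex.I : ℂ) ≠ 0 := Complex.two_pi_I_ne_zero
    have h3 : ((s : ℂ) / n) = q := by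
      refine mul_left_cancel₀ h2 ?_
      rw [hq, mul_comm]
    rw [div_eq_iff hn0] at h3
    rw [mul_comm]
    exact_mod_cast h3
  have hgeom : ∑ k ∈ Finset.range n, z ^ k = 0 := by
    have h := geom_sum_mul z n
    rw [hzn, sub_self] at h
    exact (mul_eq_zero.1 h).resolve_right (sub_ne_zero.2 hz1)
  have hsum : ∑ k ∈ Finset.Icc 1 n, z ^ k = 0 := by
    have e : Finset.Icc 1 n = Finset.Ico 1 (n + 1) := by ext; simp
    rw [e, Finset.sum_Ico_eq_sum_range]
    simp only [add_tsub_cancel_right, pow_add, pow_one, ← Finset.mul_sum, hgeom, mul_zero]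
  have hre : ∀ k : ℕ, Real.cos ((k : ℝ) * (2 * Real.pi * s / n) + γ) =
      (Complex.exp (γ * Complex.I) * z ^ k).re := by
    intro k
    rw [hz, ← Complex.exp_nat_mul, ← Complex.exp_add, ← Complex.exp_ofReal_mul_I_re]
    congr 2
    push_cast
    ring
  simp_rw [hre]
  rw [← Complex.re_sum, ← Finset.mul_sum, hsum, mul_zero, Complex.zero_re]

/-- Product-to-sum yields the frequencies `i + j` and `j - i`. Since `i, j ≤ (n - 1) / 2`, we have
`0 < i + j < n`, so the first never resonates, and the second does only for `i = j`. Arbitrary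
phases treat cosines and sines together. -/
theorem fourierFreq_sum_cos_mul_cos {n i j : ℕ} (hi : 1 ≤ i) (hj : 1 ≤ j)
    (hin : i ≤ halfCount n) (hjn : j ≤ halfCount n) (α β : ℝ) (h : ℤ) :
    ∑ k ∈ Finset.Icc 1 n, Real.cos ((k : ℝ) * fourierFreq n i + α) *
        Real.cos (((k : ℝ) + h) * fourierFreq n j + β)
      = if i = j then (n : ℝ) / 2 * Real.cos (h * fourierFreq n j + (β - α)) else 0 := by
  simp only [halfCount] at hin hjn
  have hn : 0 < n := by lia
  have hn0 : (n : ℝ) ≠ 0 := by exact_mod_cast hn.ne'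
  have hprod : ∀ k : ℕ, Real.cos ((k : ℝ) * fourierFreq n i + α) *
        Real.cos (((k : ℝ) + h) * fourierFreq n j + β) =
      1 / 2 * Real.cos ((k : ℝ) * (2 * Real.pi * ((i + j : ℤ) : ℝ) / n)
        + (α + β + h * fourierFreq n j)) +
      1 / 2 * Real.cos ((k : ℝ) * (2 * Real.pi * ((j - i : ℤ) : ℝ) / n)
        + (h * fourierFreq n j + (β - α))) := by
    intro k
    have e1 : (k : ℝ) * (2 * Real.pi * ((i + j : ℤ) : ℝ) / n) + (α + β + h * fourierFreq n j) =
        (((k : ℝ) + h) * fourierFreq n j + β) + ((k : ℝ) * fourierFreq n i + α) := by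
      simp only [fourierFreq]; push_cast; ring
    have e2 : (k : ℝ) * (2 * Real.pi * ((j - i : ℤ) : ℝ) / n) + (h * fourierFreq n j + (β - α)) =
        (((k : ℝ) + h) * fourierFreq n j + β) - ((k : ℝ) * fourierFreq n i + α) := by
      simp only [fourierFreq]; push_cast; ring
    rw [e1, e2]
    generalize (k : ℝ) * fourierFreq n i + α = x
    generalize ((k : ℝ) + h) * fourierFreq n j + β = y
    rw [Real.cos_add, Real.cos_sub]
    ring
  rw [Finset.sum_congr rfl fun k _ => hprod k, Finset.sum_add_distrib, ← Finset.mul_sum,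
    ← Finset.mul_sum, sum_cos_eq_zero hn ?_, mul_zero, zero_add]
  · split_ifs with hij
    · subst hij
      simp
      ring
    · rw [sum_cos_eq_zero hn, mul_zero]
      intro hd
      have := Int.eq_zero_of_abs_lt_dvd hd (by rw [abs_lt]; lia)
      lia
  · intro hd
    have := Int.le_of_dvd (by lia) hd
    lia

theorem sum_Icc_natCast (n : ℕ) (g : ℤ → ℝ) :
    ∑ k ∈ Finset.Icc 1 n, g k = ∑ l ∈ Finset.Icc (1 : ℤ) n, g l := by
  refine Finset.sum_nbij (fun k : ℕ => (k : ℤ)) (fun k hk => ?_) (fun a _ b _ h => ?_)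
    (fun l hl => ?_) fun _ _ => rfl
  · simp only [Finset.mem_Icc] at hk ⊢; lia
  · simpa using h
  · simp only [Finset.coe_Icc, Set.mem_Icc] at hl
    exact ⟨l.toNat, by simp only [Finset.coe_Icc, Set.mem_Icc]; lia, by simp only; lia⟩

/-- The number of `k ∈ {1, …, n}` with `k + h ∉ {1, …, n}`. -/
noncomputable def boundaryCount (n : ℕ) (h : ℤ) : ℕ :=
  ((Finset.Icc 1 n).filter fun k : ℕ => (k : ℤ) + h ∉ Finset.Icc (1 : ℤ) n).card

theorem boundaryCount_le (n : ℕ) (h : ℤ) : boundaryCount n h ≤ n :=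
  (Finset.card_filter_le _ _).trans (by simp)

theorem boundaryCount_le_natAbs (n : ℕ) (h : ℤ) : boundaryCount n h ≤ h.natAbs := by
  rcases le_total 0 h with h0 | h0
  · refine (Finset.card_le_card (t := Finset.Ioc (n - h.natAbs) n) fun k hk => ?_).trans
      (by rw [Nat.card_Ioc]; lia)
    simp only [Finset.mem_filter, Finset.mem_Icc, Finset.mem_Ioc] at hk ⊢
    lia
  · refine (Finset.card_le_card (t := Finset.Icc 1 h.natAbs) fun k hk => ?_).trans
      (by rw [Nat.card_Icc]; lia)
    simp only [Finset.mem_filter, Finset.mem_Icc] at hk ⊢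
    lia

theorem summable_mul_boundaryCount {r : ℤ → ℝ} (hr : Summable r) (n : ℕ) :
    Summable fun h => |r h| * boundaryCount n h := by
  refine Summable.of_nonneg_of_le (fun h => by positivity) (fun h => ?_) (hr.abs.mul_right (n : ℝ))
  have : (boundaryCount n h : ℝ) ≤ n := by exact_mod_cast boundaryCount_le n h
  gcongr

/-- Dominated convergence: the count is at most `|h|`, giving the pointwise limit, and at most `n`,
giving the dominating function `|r h|`. -/
theorem tendsto_boundary_error {r : ℤ → ℝ} (hr : Summable r) :
    Tendsto (fun n : ℕ => (∑' h, |r h| * boundaryCount n h) / n) atTop (𝓝 0) := by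
  have h0 : (0 : ℝ) = ∑' _ : ℤ, (0 : ℝ) := tsum_zero.symm
  simp_rw [← tsum_div_const]
  rw [h0]
  refine tendsto_tsum_of_dominated_convergence hr.abs (fun h => ?_)
    (Eventually.of_forall fun n h => ?_)
  · refine squeeze_zero (fun n => by positivity) (fun n => ?_)
      (tendsto_const_div_atTop_nhds_zero_nat (|r h| * h.natAbs))
    have : (boundaryCount n h : ℝ) ≤ h.natAbs := by exact_mod_cast boundaryCount_le_natAbs n h
    gcongr
  · rw [Real.norm_eq_abs, abs_of_nonneg (by positivity)]
    rcases Nat.eq_zero_or_pos n with hn | hn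
    · subst hn; simp
    · rw [div_le_iff₀ (by exact_mod_cast hn)]
      have : (boundaryCount n h : ℝ) ≤ n := by exact_mod_cast boundaryCount_le n h
      gcongr

/-- Substituting `l = k + h` and dropping the constraint `1 ≤ k + h ≤ n` makes the sum over `k` a
complete period. Only the pairs `(k, h)` violating the constraint contribute to the error. -/
theorem abs_double_sum_sub_le {r : ℤ → ℝ} (hr : Summable r) (n : ℕ) (A B : ℤ → ℝ)
    (hA : ∀ k, |A k| ≤ 1) (hB : ∀ k, |B k| ≤ 1) :
    |∑ k ∈ Finset.Icc 1 n, ∑ l ∈ Finset.Icc 1 n, A k * B l * r (l - k)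
      - ∑' h, r h * ∑ k ∈ Finset.Icc 1 n, A k * B (k + h)|
      ≤ ∑' h, |r h| * boundaryCount n h := by
  classical
  let F : ℕ → ℤ → ℝ := fun k h =>
    if (k : ℤ) + h ∈ Finset.Icc (1 : ℤ) n then r h * (A k * B (k + h)) else 0
  have hAB : ∀ k h, |r h * (A k * B (k + h))| ≤ |r h| := fun k h => by
    rw [abs_mul, abs_mul]
    exact mul_le_of_le_one_right (abs_nonneg _)
      (mul_le_one₀ (hA _) (abs_nonneg _) (hB _))
  have hFs : ∀ k, Summable (F k) := fun k =>
    Summable.of_norm_bounded hr.abs fun h => by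
      simp only [F, Real.norm_eq_abs]
      split_ifs
      · exact hAB k h
      · simp
  have h1 : ∀ k : ℕ, ∑ l ∈ Finset.Icc 1 n, A k * B l * r (l - k) = ∑' h, F k h := by
    intro k
    rw [sum_Icc_natCast n fun l => A k * B l * r (l - k), ← (Equiv.subRight (k : ℤ)).tsum_eq,
      tsum_eq_sum (s := Finset.Icc (1 : ℤ) n)]
    · refine Finset.sum_congr rfl fun l hl => ?_
      simp only [F, Equiv.subRight_apply, add_sub_cancel, if_pos hl]
      ring
    · intro l hl
      simp only [F, Equiv.subRight_apply, add_sub_cancel, if_neg hl]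
  have hGs : ∀ k : ℕ, Summable fun h => r h * (A k * B (k + h)) := fun k =>
    Summable.of_norm_bounded hr.abs fun h => hAB k h
  simp_rw [h1, Finset.mul_sum]
  rw [← Summable.tsum_finsetSum fun k _ => hFs k,
    ← Summable.tsum_sub (summable_sum fun k _ => hFs k) (summable_sum fun k _ => hGs k)]
  rw [← Real.norm_eq_abs]
  refine (norm_tsum_le_tsum_norm ?_).trans ?_
  · exact ((summable_sum fun k _ => hFs k).sub (summable_sum fun k _ => hGs k)).norm
  · refine Summable.tsum_le_tsum (fun h => ?_)
      ((summable_sum fun k _ => hFs k).sub (summable_sum fun k _ => hGs k)).norm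
      (summable_mul_boundaryCount hr n)
    rw [← Finset.sum_sub_distrib, boundaryCount, mul_comm, ← nsmul_eq_mul, ← Finset.sum_const,
      Finset.sum_filter]
    refine norm_sum_le_of_le _ fun k _ => ?_
    simp only [F, Real.norm_eq_abs]
    split_ifs
    · simp
    · rw [zero_sub, abs_neg]; exact hAB k h

/-- The sine part of the addition formula is odd in `h` and cancels because `r` is even. -/
theorem tsum_mul_cos_add {r : ℤ → ℝ} (hr : Summable r) (heven : ∀ h, r (-h) = r h) (θ γ : ℝ) :
    ∑' h : ℤ, r h * Real.cos (h * θ + γ) = Real.cos γ * ∑' h : ℤ, r h * Real.cos (h * θ) := by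
  have hc : Summable fun h : ℤ => r h * Real.cos (h * θ) :=
    Summable.of_norm_bounded hr.abs fun h => by
      rw [norm_mul, Real.norm_eq_abs, Real.norm_eq_abs]
      exact mul_le_of_le_one_right (abs_nonneg _) (Real.abs_cos_le_one _)
  have hs : Summable fun h : ℤ => r h * Real.sin (h * θ) :=
    Summable.of_norm_bounded hr.abs fun h => by
      rw [norm_mul, Real.norm_eq_abs, Real.norm_eq_abs]
      exact mul_le_of_le_one_right (abs_nonneg _) (Real.abs_sin_le_one _)
  have hodd : ∑' h : ℤ, r h * Real.sin (h * θ) = 0 := by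
    have h := (Equiv.neg ℤ).tsum_eq fun h : ℤ => r h * Real.sin (h * θ)
    simp only [Equiv.neg_apply, heven, Int.cast_neg, neg_mul, Real.sin_neg, mul_neg,
      tsum_neg] at h
    linarith
  have e : ∀ h : ℤ, r h * Real.cos (h * θ + γ) =
      Real.cos γ * (r h * Real.cos (h * θ)) - Real.sin γ * (r h * Real.sin (h * θ)) := fun h => by
    rw [Real.cos_add]; ring
  simp_rw [e]
  rw [(hc.mul_left _).tsum_sub (hs.mul_left _), tsum_mul_left, tsum_mul_left, hodd, mul_zero,
    sub_zero]

variable {Ω : Type*} [MeasurableSpace Ω]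

theorem two_pi_mul_spectralDensity {P : Measure Ω} {X : ℤ → Ω → ℝ} (hr : Summable (autocov P X))
    (θ : ℝ) :
    2 * Real.pi * spectralDensity P X θ = ∑' h : ℤ, autocov P X h * Real.cos (h * θ) := by
  have hs : Summable fun k : ℤ =>
      (autocov P X k : ℂ) * Complex.exp (Complex.I * (k : ℂ) * (θ : ℂ)) := by
    refine Summable.of_norm_bounded hr.abs fun k => ?_
    have e : Complex.I * (k : ℂ) * (θ : ℂ) = ((k * θ : ℝ) : ℂ) * Complex.I := by push_cast; ring
    rw [norm_mul, e, Complex.norm_exp_ofReal_mul_I, mul_one, Complex.norm_real, Real.norm_eq_abs]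
  rw [spectralDensity, ← mul_assoc, mul_one_div_cancel (by positivity), one_mul, Complex.re_tsum hs]
  refine tsum_congr fun k => ?_
  have e : Complex.I * (k : ℂ) * (θ : ℂ) = ((k * θ : ℝ) : ℂ) * Complex.I := by push_cast; ring
  rw [e, Complex.re_ofReal_mul, Complex.exp_ofReal_mul_I_re]

/-- Covariances of Fourier coefficients with phases. -/
theorem abs_fourier_double_sum_sub_le {P : Measure Ω} {X : ℤ → Ω → ℝ}
    (hr : Summable (autocov P X)) (heven : ∀ h, autocov P X (-h) = autocov P X h)
    {n i j : ℕ} (hi : 1 ≤ i) (hj : 1 ≤ j)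
    (hin : i ≤ halfCount n) (hjn : j ≤ halfCount n) (α β : ℝ) :
    |∑ k ∈ Finset.Icc 1 n, ∑ l ∈ Finset.Icc 1 n, Real.cos ((k : ℝ) * fourierFreq n i + α) *
        Real.cos ((l : ℝ) * fourierFreq n j + β) * autocov P X ((l : ℤ) - (k : ℤ))
      - if i = j then Real.cos (β - α) * (Real.pi * n * spectralDensity P X (fourierFreq n j))
        else 0| ≤ ∑' h, |autocov P X h| * boundaryCount n h := by
  have h := abs_double_sum_sub_le hr n (fun k => Real.cos ((k : ℝ) * fourierFreq n i + α))
    (fun l => Real.cos ((l : ℝ) * fourierFreq n j + β)) (fun k => Real.abs_cos_le_one _)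
    (fun k => Real.abs_cos_le_one _)
  simp only [Int.cast_natCast, Int.cast_add,
    fourierFreq_sum_cos_mul_cos hi hj hin hjn α β] at h
  convert h using 3
  split_ifs with hij
  · have e : ∀ h : ℤ, autocov P X h * ((n : ℝ) / 2 * Real.cos (h * fourierFreq n j + (β - α))) =
        (n : ℝ) / 2 * (autocov P X h * Real.cos (h * fourierFreq n j + (β - α))) := fun h => by ring
    simp_rw [e]
    rw [tsum_mul_left, tsum_mul_cos_add hr heven, ← two_pi_mul_spectralDensity hr]
    ring
  · simp

end Trigonometry

/-! ### Weights and variance of the Fourier coefficients, and the limit along sequences. -/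

section Assembly

set_option linter.unusedSectionVars false

variable {Ω E : Type*} [mΩ : MeasurableSpace Ω] [mE : MeasurableSpace E]

/-- The index of the Fourier frequency belonging to the coordinate `q` of the Fourier vector. -/
def freqIndex (n q : ℕ) : ℕ := if q ≤ halfCount n then q else q - halfCount n

/-- The phase belonging to the coordinate `q` of the Fourier vector. -/
noncomputable def phase (n q : ℕ) : ℝ := if q ≤ halfCount n then 0 else -(Real.pi / 2)

/-- The weight of `X_k` in the coordinate `q` of the normalized Fourier vector. -/
noncomputable def fourierWeight (P : Measure Ω) (X : ℤ → Ω → ℝ) (n q k : ℕ) : ℝ :=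
  Real.cos ((k : ℝ) * fourierFreq n (freqIndex n q) + phase n q) /
    √(Real.pi * n * spectralDensity P X (fourierFreq n (freqIndex n q)))

theorem normFourier_eq_sum (P : Measure Ω) (X : ℤ → Ω → ℝ) (n q : ℕ) (ω : Ω) :
    normFourier P X n q ω = ∑ k ∈ Finset.Icc 1 n, fourierWeight P X n q k * X k ω := by
  simp only [normFourier, fourierWeight, freqIndex, phase]
  split_ifs
  · rw [Finset.sum_div]
    refine Finset.sum_congr rfl fun k _ => ?_
    rw [add_zero]; ring
  · rw [Finset.sum_div]
    refine Finset.sum_congr rfl fun k _ => ?_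
    rw [← sub_eq_add_neg, Real.cos_sub_pi_div_two]; ring

theorem freqIndex_mem {n q : ℕ} (hq : q ∈ Finset.Icc 1 (2 * halfCount n)) :
    1 ≤ freqIndex n q ∧ freqIndex n q ≤ halfCount n := by
  rw [Finset.mem_Icc] at hq
  simp only [freqIndex]
  split_ifs <;> lia

/-- Two distinct coordinates with the same frequency are its cosine and its sine, whose phases
differ by `π/2`. -/
theorem cos_phase_sub {n q q' : ℕ} (h : freqIndex n q = freqIndex n q') :
    Real.cos (phase n q' - phase n q) = if q = q' then 1 else 0 := by
  simp only [freqIndex] at h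
  simp only [phase]
  split_ifs at h ⊢ <;> first | lia | simp

/-- The coefficients are asymptotically orthonormal, at a rate that does not depend on the
coordinates: the lower bound on `f` bounds the normalizers below by `√(π n fmin)`. -/
theorem abs_sum_fourierWeight_sub_le {P : Measure Ω} {X : ℤ → Ω → ℝ}
    (hr : Summable (autocov P X)) (heven : ∀ h, autocov P X (-h) = autocov P X h)
    {fmin : ℝ} (hpos : 0 < fmin) (hf : ∀ θ, fmin ≤ spectralDensity P X θ) {n q q' : ℕ}
    (hq : q ∈ Finset.Icc 1 (2 * halfCount n)) (hq' : q' ∈ Finset.Icc 1 (2 * halfCount n)) :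
    |∑ k ∈ Finset.Icc 1 n, ∑ l ∈ Finset.Icc 1 n,
        fourierWeight P X n q k * fourierWeight P X n q' l * autocov P X ((l : ℤ) - (k : ℤ))
      - if q = q' then 1 else 0|
      ≤ (∑' h, |autocov P X h| * boundaryCount n h) / n / (Real.pi * fmin) := by
  obtain ⟨h1, h2⟩ := freqIndex_mem hq
  obtain ⟨h1', h2'⟩ := freqIndex_mem hq'
  have hn : (0 : ℝ) < n := by
    have : 0 < n := by simp only [halfCount] at h2; lia
    exact_mod_cast this
  have key := abs_fourier_double_sum_sub_le hr heven h1 h1' h2 h2' (phase n q) (phase n q')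
  set s := √(Real.pi * n * spectralDensity P X (fourierFreq n (freqIndex n q))) with hs
  set s' := √(Real.pi * n * spectralDensity P X (fourierFreq n (freqIndex n q'))) with hs'
  have hlow : √(Real.pi * n * fmin) ≤ s := by
    refine Real.sqrt_le_sqrt ?_
    have := hf (fourierFreq n (freqIndex n q))
    gcongr
  have hlow' : √(Real.pi * n * fmin) ≤ s' := by
    refine Real.sqrt_le_sqrt ?_
    have := hf (fourierFreq n (freqIndex n q'))
    gcongr
  have h0 : 0 < √(Real.pi * n * fmin) := Real.sqrt_pos.2 (by positivity)
  have hspos : 0 < s := h0.trans_le hlow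
  have hspos' : 0 < s' := h0.trans_le hlow'
  have hss : Real.pi * n * fmin ≤ s * s' := by
    rw [← Real.mul_self_sqrt (show 0 ≤ Real.pi * n * fmin by positivity)]
    exact mul_le_mul hlow hlow' h0.le hspos.le
  set V := ∑ k ∈ Finset.Icc 1 n, ∑ l ∈ Finset.Icc 1 n,
    Real.cos ((k : ℝ) * fourierFreq n (freqIndex n q) + phase n q) *
      Real.cos ((l : ℝ) * fourierFreq n (freqIndex n q') + phase n q') *
        autocov P X ((l : ℤ) - (k : ℤ)) with hV
  set D := ∑' h, |autocov P X h| * boundaryCount n h with hD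
  have e1 : ∑ k ∈ Finset.Icc 1 n, ∑ l ∈ Finset.Icc 1 n,
        fourierWeight P X n q k * fourierWeight P X n q' l * autocov P X ((l : ℤ) - (k : ℤ))
      = V / (s * s') := by
    rw [hV, Finset.sum_div]
    refine Finset.sum_congr rfl fun k _ => ?_
    rw [Finset.sum_div]
    refine Finset.sum_congr rfl fun l _ => ?_
    rw [fourierWeight, fourierWeight, ← hs, ← hs', div_mul_div_comm, div_mul_eq_mul_div]
  have e2 : (if freqIndex n q = freqIndex n q' then Real.cos (phase n q' - phase n q) *
      (Real.pi * n * spectralDensity P X (fourierFreq n (freqIndex n q'))) else 0) =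
      (if q = q' then 1 else 0) * (s * s') := by
    by_cases hqq : q = q'
    · subst hqq
      have hge := hf (fourierFreq n (freqIndex n q))
      rw [hs', Real.mul_self_sqrt (mul_nonneg (by positivity) (hpos.le.trans hge))]
      simp
    · rw [if_neg hqq, zero_mul]
      split_ifs with hfq
      · rw [cos_phase_sub hfq, if_neg hqq, zero_mul]
      · rfl
  rw [e2] at key
  have hss0 : 0 < s * s' := mul_pos hspos hspos'
  have e3 : V / (s * s') - (if q = q' then 1 else 0) =
      (V - (if q = q' then 1 else 0) * (s * s')) / (s * s') := by
    field_simp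
  have hD0 : 0 ≤ D := tsum_nonneg fun h => by positivity
  rw [e1, e3, abs_div, abs_of_pos hss0]
  calc _ ≤ D / (s * s') := div_le_div_of_nonneg_right key hss0.le
    _ ≤ D / (Real.pi * n * fmin) := div_le_div_of_nonneg_left hD0 (by positivity) hss
    _ = D / n / (Real.pi * fmin) := by field_simp

theorem abs_fourierWeight_le {P : Measure Ω} {X : ℤ → Ω → ℝ} {fmin : ℝ} (hpos : 0 < fmin)
    (hf : ∀ θ, fmin ≤ spectralDensity P X θ) (n q k : ℕ) :
    |fourierWeight P X n q k| ≤ 1 / √(Real.pi * fmin) / √n := by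
  rcases Nat.eq_zero_or_pos n with hn | hn
  · subst hn; simp [fourierWeight]
  have hn' : (0 : ℝ) < n := by exact_mod_cast hn
  have hge := hf (fourierFreq n (freqIndex n q))
  rw [fourierWeight, abs_div, abs_of_nonneg (Real.sqrt_nonneg _), div_div,
    ← Real.sqrt_mul (by positivity)]
  refine div_le_div₀ zero_le_one (Real.abs_cos_le_one _) (Real.sqrt_pos.2 (by positivity))
    (Real.sqrt_le_sqrt ?_)
  rw [mul_right_comm]
  gcongr

/-- The variance of a normalized combination of distinct Fourier coefficients. -/
theorem abs_variance_sub_one_le {P : Measure Ω} {X : ℤ → Ω → ℝ}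
    (hr : Summable (autocov P X)) (heven : ∀ h, autocov P X (-h) = autocov P X h)
    {fmin : ℝ} (hpos : 0 < fmin) (hf : ∀ θ, fmin ≤ spectralDensity P X θ) {n p : ℕ}
    (j : Fin p → ℕ) (hinj : Function.Injective j)
    (hj : ∀ u, j u ∈ Finset.Icc 1 (2 * halfCount n)) (c : Fin p → ℝ) (hc : ∑ u, c u ^ 2 = 1) :
    |∑ k ∈ Finset.Icc 1 n, ∑ l ∈ Finset.Icc 1 n, (∑ u, c u * fourierWeight P X n (j u) k) *
        (∑ v, c v * fourierWeight P X n (j v) l) * autocov P X ((l : ℤ) - (k : ℤ)) - 1|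
      ≤ p ^ 2 * ((∑' h, |autocov P X h| * boundaryCount n h) / n / (Real.pi * fmin)) := by
  set R := (∑' h, |autocov P X h| * boundaryCount n h) / n / (Real.pi * fmin)
  have hc1 : ∀ u, |c u| ≤ 1 := fun u => by
    rw [← sq_le_one_iff_abs_le_one, ← hc]
    exact Finset.single_le_sum (f := fun u => c u ^ 2) (fun _ _ => sq_nonneg _)
      (Finset.mem_univ u)
  have e1 : ∑ k ∈ Finset.Icc 1 n, ∑ l ∈ Finset.Icc 1 n,
        (∑ u, c u * fourierWeight P X n (j u) k) *
        (∑ v, c v * fourierWeight P X n (j v) l) * autocov P X ((l : ℤ) - (k : ℤ)) =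
      ∑ u, ∑ v, c u * c v * ∑ k ∈ Finset.Icc 1 n, ∑ l ∈ Finset.Icc 1 n,
        fourierWeight P X n (j u) k * fourierWeight P X n (j v) l *
          autocov P X ((l : ℤ) - (k : ℤ)) := by
    simp_rw [Finset.sum_mul_sum, Finset.sum_mul, Finset.mul_sum]
    rw [Finset.sum_congr rfl fun k _ => Finset.sum_comm, Finset.sum_comm]
    refine Finset.sum_congr rfl fun u _ => ?_
    rw [Finset.sum_congr rfl fun k _ => Finset.sum_comm, Finset.sum_comm]
    refine Finset.sum_congr rfl fun v _ => Finset.sum_congr rfl fun k _ =>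
      Finset.sum_congr rfl fun l _ => ?_
    ring
  have e2 : (1 : ℝ) = ∑ u, ∑ v, c u * c v * if j u = j v then 1 else 0 := by
    refine hc.symm.trans (Finset.sum_congr rfl fun u _ => ?_)
    simp [hinj.eq_iff, sq]
  rw [e1]
  conv_lhs => rw [e2]
  rw [← Finset.sum_sub_distrib]
  simp_rw [← Finset.sum_sub_distrib, ← mul_sub]
  have hterm : ∀ u v, |c u * c v * (∑ k ∈ Finset.Icc 1 n, ∑ l ∈ Finset.Icc 1 n,
        fourierWeight P X n (j u) k * fourierWeight P X n (j v) l *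
          autocov P X ((l : ℤ) - (k : ℤ)) - if j u = j v then 1 else 0)| ≤ R := fun u v => by
    rw [abs_mul, abs_mul]
    refine (mul_le_of_le_one_left (abs_nonneg _)
      (mul_le_one₀ (hc1 u) (abs_nonneg _) (hc1 v))).trans ?_
    exact abs_sum_fourierWeight_sub_le hr heven hpos hf (hj u) (hj v)
  calc _ ≤ ∑ _u : Fin p, ∑ _v : Fin p, R := by
        refine (Finset.abs_sum_le_sum_abs _ _).trans (Finset.sum_le_sum fun u _ => ?_)
        exact (Finset.abs_sum_le_sum_abs _ _).trans (Finset.sum_le_sum fun v _ => hterm u v)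
    _ = p ^ 2 * R := by simp; ring

variable {P : Measure Ω} [IsProbabilityMeasure P] {ε : ℤ → Ω → E} {G : (ℕ → E) → ℝ}

theorem integral_sq_weighted_sum (hG : Measurable G)
    (hi : iIndepFun ε P) (hid : ∀ i j, IdentDistrib (ε i) (ε j) P P)
    (hX : ∀ t, MemLp (causalProcess G ε t) 2 P) (s : Finset ℕ) (a : ℕ → ℝ) :
    ∫ ω, (∑ k ∈ s, a k * causalProcess G ε (k : ℕ) ω) ^ 2 ∂P =
      ∑ k ∈ s, ∑ l ∈ s, a k * a l * autocov P (causalProcess G ε) ((l : ℤ) - (k : ℤ)) := by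
  rw [← norm_toLp_sq (memLp_sum_mul s a fun k : ℕ => hX k),
    toLp_sum_mul s a fun k : ℕ => hX k,
    ← real_inner_self_eq_norm_sq, sum_inner]
  refine Finset.sum_congr rfl fun k _ => ?_
  rw [inner_sum]
  refine Finset.sum_congr rfl fun l _ => ?_
  rw [inner_smul_left, inner_smul_right, inner_toLp, integral_mul_eq_autocov hG hi hid]
  simp [mul_assoc]

/-- The central limit theorem along sequences of index sets, directions and arguments. -/
theorem tendsto_fourier_cdf (hG : Measurable G) (hε : ∀ i, Measurable (ε i))
    (hi : iIndepFun ε P) (hid : ∀ i j, IdentDistrib (ε i) (ε j) P P)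
    (hX : ∀ t, MemLp (causalProcess G ε t) 2 P) (hmean : ∀ t, ∫ ω, causalProcess G ε t ω ∂P = 0)
    (hu : Summable (hannanCoeff P G ε)) {fmin : ℝ} (hpos : 0 < fmin)
    (hf : ∀ θ, fmin ≤ spectralDensity P (causalProcess G ε) θ) {p : ℕ} {n : ℕ → ℕ}
    (hn : Tendsto n atTop atTop) (J : ∀ i, IndexSet (halfCount (n i)) p)
    (c : ℕ → Metric.sphere (0 : EuclideanSpace ℝ (Fin p)) 1) (x : ℕ → ℝ) :
    Tendsto (fun i => |P.real {ω | ∑ l, normFourierVec P (causalProcess G ε) (n i) (J i) ω l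
      * (c i).1 l ≤ x i} - cdf (gaussianReal 0 1) (x i)|) atTop (𝓝 0) := by
  have hr := summable_autocov hG hε hi hid hX hmean hu
  have heven := autocov_neg hG hi hid
  have hc : ∀ i, ∑ u, (c i).1 u ^ 2 = 1 := fun i => by
    have h := (c i).2
    rw [mem_sphere_zero_iff_norm] at h
    rw [← EuclideanSpace.real_norm_sq_eq, h, one_pow]
  let j : ∀ i, Fin p → ℕ := fun i u => (J i).1.orderEmbOfFin (J i).2.2 u
  let a : ℕ → ℕ → ℝ := fun i k =>
    ∑ u, (c i).1 u * fourierWeight P (causalProcess G ε) (n i) (j i u) k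
  have hsum : ∀ i ω, ∑ l, normFourierVec P (causalProcess G ε) (n i) (J i) ω l * (c i).1 l =
      ∑ k ∈ Finset.Icc 1 (n i), a i k * causalProcess G ε (k : ℕ) ω := by
    intro i ω
    simp only [normFourierVec, normFourier_eq_sum, a, Finset.sum_mul]
    rw [Finset.sum_comm]
    refine Finset.sum_congr rfl fun k _ => Finset.sum_congr rfl fun u _ => ?_
    simp only [j]
    ring
  simp only [hsum]
  refine tendsto_cdf_sub_of_tendsto_charFun
    (fun i => (memLp_sum_mul _ _ fun k : ℕ => hX k).aestronglyMeasurable.aemeasurable) ?_ x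
  -- Taking `p + 1` in place of `p` keeps `C` positive for `p = 0`.
  refine tendsto_charFun_weighted_sum hG hε hi hid hX hmean hu
    (C := (p + 1) * (1 / √(Real.pi * fmin))) (by positivity) hn a (fun i k _ => ?_) ?_
  · calc |a i k| ≤ ∑ u : Fin p, 1 / √(Real.pi * fmin) / √(n i) := by
          refine (Finset.abs_sum_le_sum_abs _ _).trans (Finset.sum_le_sum fun u _ => ?_)
          rw [abs_mul]
          refine (mul_le_of_le_one_left (abs_nonneg _) ?_).trans (abs_fourierWeight_le hpos hf _ _ _)
          rw [← sq_le_one_iff_abs_le_one]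
          exact (Finset.single_le_sum (f := fun u => (c i).1 u ^ 2) (fun _ _ => sq_nonneg _)
            (Finset.mem_univ u)).trans_eq (hc i)
      _ = p * (1 / √(Real.pi * fmin) / √(n i)) := by simp
      _ ≤ (p + 1) * (1 / √(Real.pi * fmin) / √(n i)) := by gcongr; linarith
      _ = _ := by ring
  · have herr := (((tendsto_boundary_error hr).comp hn).div_const (Real.pi * fmin)).const_mul
      ((p : ℝ) ^ 2)
    rw [zero_div, mul_zero] at herr
    rw [tendsto_iff_dist_tendsto_zero]
    refine squeeze_zero (fun _ => dist_nonneg) (fun i => ?_) herr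
    rw [integral_sq_weighted_sum hG hi hid hX, Real.dist_eq]
    exact abs_variance_sub_one_le hr heven hpos hf (j i) ((J i).1.orderEmbOfFin _).injective
      (fun u => (J i).2.1 (Finset.orderEmbOfFin_mem _ _ u)) (c i).1 (hc i)

end Assembly

end SpectralCLT

theorem theorem2p1 {Ω E : Type*} [MeasurableSpace Ω] [MeasurableSpace E]
    (P : Measure Ω) [IsProbabilityMeasure P]
    -- i.i.d. innovations
    (ε : ℤ → Ω → E) (hε_meas : ∀ i, Measurable (ε i)) (hε_indep : iIndepFun ε P)
    (hε_ident : ∀ i j, IdentDistrib (ε i) (ε j) P P)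
    -- the stationary causal process
    (G : (ℕ → E) → ℝ) (hG : Measurable G)
    (X : ℤ → Ω → ℝ) (hX : X = SpectralCLT.causalProcess G ε)
    (hX_L2 : ∀ t, MemLp (X t) 2 P) (hX_mean : ∀ t, ∫ ω, X t ω ∂P = 0)
    -- Hannan's condition
    (hκ : ∑' k : ℕ, eLpNorm (SpectralCLT.proj P ε 0 (X (k : ℤ))) 2 P < ∞)
    -- the minimum of the spectral density is positive
    (fmin : ℝ) (hfmin : IsLeast (Set.range (SpectralCLT.spectralDensity P X)) fmin)
    (hfmin_pos : 0 < fmin)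
    (p : ℕ) :
    Tendsto
      (fun n : ℕ =>
        ⨆ (J : SpectralCLT.IndexSet (SpectralCLT.halfCount n) p)
          (c : Metric.sphere (0 : EuclideanSpace ℝ (Fin p)) 1) (x : ℝ),
          ENNReal.ofReal
            |P.real {ω | ∑ l, SpectralCLT.normFourierVec P X n J ω l * c.1 l ≤ x}
              - cdf (gaussianReal 0 1) x|)
      atTop (𝓝 0) := by
  subst hX
  have hu : Summable (SpectralCLT.hannanCoeff P G ε) := ENNReal.summable_toReal hκ.ne
  rw [ENNReal.tendsto_atTop_zero]
  -- Failure yields some `n ≥ N` for every `N` with supremum above `δ`, hence a particular `J`, `c`,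
  -- `x` with error above `δ`. This is the sequence fed to `tendsto_fourier_cdf`, so the supremum
  -- itself never has to be handled.
  by_contra! hcon
  obtain ⟨δ, hδ, hcon⟩ := hcon
  choose n hn hlt using hcon
  simp only [lt_iSup_iff] at hlt
  choose J c x hlt using hlt
  have h := SpectralCLT.tendsto_fourier_cdf hG hε_meas hε_indep hε_ident hX_L2 hX_mean hu
    hfmin_pos (fun θ => hfmin.2 ⟨θ, rfl⟩) (tendsto_atTop_mono hn tendsto_id) J c x
  have h' := ENNReal.tendsto_ofReal h
  rw [ENNReal.ofReal_zero] at h'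
  obtain ⟨i, hi⟩ := (h'.eventually (gt_mem_nhds hδ)).exists
  exact lt_asymm hi (hlt i)
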